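/- Let $G$ be a finite-dimensional real Lie group with Lie algebra $\mathfrak g=T_1G$, let $K\subset G$ be a closed subgroup with Lie algebra $\mathfrak k\subset\mathfrak g$, and let $M$ be the homogeneous space of right cosets $Kg$, with its standard smooth structure, i.e. the one for which the canonical projection $\pi:G\to M$, $\pi(g)=Kg$, is a smooth submersion. Let $C\in\mathrm{Sym}^2\mathfrak g$ be a symmetric contravariant 2-tensor. For $C=\sum C^{ab}a_a\otimes a_b$ let $C^L=\sum C^{ab}a_a^L\otimes a_b^L$ be the left-invariant tensor field on $G$ with value $C$ at $1$, and for $\alpha\in\mathfrak g^*$ let $\alpha^R$ be the right-invariant 1-form with value $\alpha$ at $1$. Let $C^\pi=\pi_*(C^L)$ be the induced (Lie-algebraic) contravariant tensor field on $M$, and let $M_0\subset M$ be the open set where $C^\pi$ is nondegenerate, regarded as a pseudo-Riemannian manifold with contravariant metric tensor $C^\pi$ and Levi-Civita connection $\nabla$. For $\alpha\in\mathfrak g^*$ annihilating $\mathfrak k$ let $H^\alpha=C^L\alpha^R$ denote the horizontal vector field on $G$ obtained by contracting $C^L$ with $\alpha^R$. Then: 1. For every $\alpha\in\mathfrak g^*$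 annihilating $\mathfrak k$, the integral curves of $H^\alpha$ project to geodesics of $M_0$: if $J\subset\mathbb R$ is open (for instance an open interval) and $\gamma:J\to G$ satisfies $\dot\gamma(t)=H^\alpha(\gamma(t))$ for all $t\in J$, then $c=\pi\circ\gamma$ is smooth and satisfies $\nabla_{\dot c}\dot c=0$ at every $t\in J$ with $c(t)\in M_0$. 2. For all $\alpha,\beta\in\mathfrak g^*$ annihilating $\mathfrak k$, at every point of $\pi^{-1}(M_0)$, $$\tilde\nabla_{H^\alpha}\,\pi_*(H^\beta)=\tfrac12\,\pi_*\big([H^\alpha,H^\beta]\big),$$ where $\tilde\nabla$ is the pullback of $\nabla$ along $\pi$, acting on sections of $\pi^*(TM_0)$, and $\pi_*(X)$ denotes the section $g\mapsto d\pi_g(X_g)$ of $\pi^*(TM)$. -/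

import Mathlib

open Set Manifold TensorProduct
open scoped ContDiff

noncomputable section

namespace LieAlgebraicMetric

/-! ### Contravariant 2-tensors on a vector space -/

section Tensor

variable {V W : Type*} [AddCommGroup V] [Module ℝ V] [AddCommGroup W] [Module ℝ W]

/-- Contraction of a contravariant 2-tensor with a covector in its first slot:
`a ⊗ b` sends the covector `α` to `α a • b`. -/
def contract (T : V ⊗[ℝ] V) : Module.Dual ℝ V →ₗ[ℝ] V :=
  dualTensorHom ℝ (Module.Dual ℝ V) V
    (TensorProduct.map (Module.Dual.eval ℝ V) LinearMap.id T)

@[simp]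
theorem contract_tmul (a b : V) (α : Module.Dual ℝ V) :
    contract (a ⊗ₜ[ℝ] b) α = α a • b := by
  simp [contract]

/-- The contravariant tensor `T` is nondegenerate. -/
def Nondegenerate (T : V ⊗[ℝ] V) : Prop :=
  Function.Bijective (contract T)

open Classical in
/-- The covariant form of a nondegenerate contravariant tensor: the bilinear form on `V` inverse
to `T` (zero, by convention, if `T` is degenerate). -/
def covariantForm (T : V ⊗[ℝ] V) : V →ₗ[ℝ] V →ₗ[ℝ] ℝ :=
  if h : Nondegenerate T then
    ((LinearEquiv.ofBijective (contract T) h).symm : V →ₗ[ℝ] Module.Dual ℝ V)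
  else 0

end Tensor

/-! ### Levi-Civita connection of a contravariant metric tensor

The metric of a pseudo-Riemannian manifold is given by a contravariant tensor field `T`. Everything
is computed in the preferred chart at a point `m`; the tangent space at `m` is identified with the
model space `F` through this very chart. -/

section LeviCivita

variable {F : Type*} [NormedAddCommGroup F] [NormedSpace ℝ F]
  {M : Type*} [TopologicalSpace M] [ChartedSpace F M]

/-- The set of points at which the tensor field `T` is nondegenerate. -/
def nondegenerateLocus (T : ∀ m : M, TangentSpace 𝓘(ℝ, F) m ⊗[ℝ] TangentSpace 𝓘(ℝ, F) m) :
    Set M :=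
  {m | Nondegenerate (T m)}

variable [FiniteDimensional ℝ F]

/-- The metric `g_{ij}(x)` in the preferred chart at `m`, as a function of the coordinate `x`. -/
def metricInChart (T : ∀ m : M, TangentSpace 𝓘(ℝ, F) m ⊗[ℝ] TangentSpace 𝓘(ℝ, F) m)
    (m : M) (x : F) : F →L[ℝ] F →L[ℝ] ℝ :=
  let p : M := (extChartAt 𝓘(ℝ, F) m).symm x
  let D : F →ₗ[ℝ] TangentSpace 𝓘(ℝ, F) p :=
    (mfderiv 𝓘(ℝ, F) 𝓘(ℝ, F) (extChartAt 𝓘(ℝ, F) m).symm x).toLinearMap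
  ((covariantForm (T p)).compl₁₂ D D).toContinuousBilinearMap

/-- The Christoffel symbol of the Levi-Civita connection at `m` in the preferred chart at `m`:
`Γ(u,v)^k = ½ g^{kl} (∂_u g(v, e_l) + ∂_v g(u, e_l) - ∂_l g(u,v))`. -/
def christoffel (T : ∀ m : M, TangentSpace 𝓘(ℝ, F) m ⊗[ℝ] TangentSpace 𝓘(ℝ, F) m)
    (m : M) (u v : TangentSpace 𝓘(ℝ, F) m) : TangentSpace 𝓘(ℝ, F) m :=
  let u' : F := u
  let v' : F := v
  let dg : F →L[ℝ] F →L[ℝ] F →L[ℝ] ℝ :=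
    fderiv ℝ (metricInChart T m) (extChartAt 𝓘(ℝ, F) m m)
  let firstKind : F →L[ℝ] ℝ := (1 / 2 : ℝ) • (dg u' v' + dg v' u' - (dg.flip u').flip v')
  contract (T m) firstKind.toLinearMap

/-- The pullback along `f : N → M` of the Levi-Civita connection: the covariant derivative in the
direction `v ∈ T_n N` of a section `s` of `f^* TM`, given at `n` in coordinates by
`(∇_v s)^k = ds^k(v) + Γ^k_{ij} (df v)^i s^j`. For `N = ℝ` and `v = 1` this is
the covariant derivative along the curve `f`. -/
def pullbackCovDeriv
    {E : Type*} [NormedAddCommGroup E] [NormedSpace ℝ E]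
    {N : Type*} [TopologicalSpace N] [ChartedSpace E N]
    (T : ∀ m : M, TangentSpace 𝓘(ℝ, F) m ⊗[ℝ] TangentSpace 𝓘(ℝ, F) m)
    (f : N → M) (s : ∀ n : N, TangentSpace 𝓘(ℝ, F) (f n)) (n : N)
    (v : TangentSpace 𝓘(ℝ, E) n) : TangentSpace 𝓘(ℝ, F) (f n) :=
  let sInChart : N → F := fun n' =>
    mfderiv 𝓘(ℝ, F) 𝓘(ℝ, F) (extChartAt 𝓘(ℝ, F) (f n)) (f n') (s n')
  let ds : F := mfderiv 𝓘(ℝ, E) 𝓘(ℝ, F) sInChart n v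
  (show TangentSpace 𝓘(ℝ, F) (f n) from ds) +
    christoffel T (f n) (mfderiv 𝓘(ℝ, E) 𝓘(ℝ, F) f n v) (s n)

/-- The velocity field of a curve. -/
def velocity (c : ℝ → M) (t : ℝ) : TangentSpace 𝓘(ℝ, F) (c t) :=
  mfderiv 𝓘(ℝ, ℝ) 𝓘(ℝ, F) c t (1 : ℝ)

/-- On the set of times `s`, the curve `c` lies in the nondegenerate locus of `T`, is smooth,
and satisfies the geodesic equation `∇_{c'} c' = 0`. -/
def IsGeodesicOn (T : ∀ m : M, TangentSpace 𝓘(ℝ, F) m ⊗[ℝ] TangentSpace 𝓘(ℝ, F) m)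
    (c : ℝ → M) (s : Set ℝ) : Prop :=
  ∀ t ∈ s, c t ∈ nondegenerateLocus T ∧ ContMDiffAt 𝓘(ℝ, ℝ) 𝓘(ℝ, F) ∞ c t ∧
    pullbackCovDeriv T c (velocity c) t (1 : ℝ) = 0

end LeviCivita

/-! ### Invariant tensors on a Lie group -/

section Group

variable {E : Type*} [NormedAddCommGroup E] [NormedSpace ℝ E]
  {G : Type*} [TopologicalSpace G] [ChartedSpace E G] [Group G]

/-- The Lie algebra of a closed subgroup `K`, as a subset of the tangent space of `G` at `1`:
initial velocities of smooth curves of `G` that lie in `K` and start at `1`. -/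
def subgroupLieAlgebra (E : Type*) [NormedAddCommGroup E] [NormedSpace ℝ E]
    {G : Type*} [TopologicalSpace G] [ChartedSpace E G] [Group G] (K : Subgroup G) :
    Set (GroupLieAlgebra 𝓘(ℝ, E) G) :=
  {a | ∃ (ε : ℝ) (c : ℝ → G), 0 < ε ∧ ContMDiffOn 𝓘(ℝ, ℝ) 𝓘(ℝ, E) ∞ c (Ioo (-ε) ε) ∧
    (∀ t ∈ Ioo (-ε) ε, c t ∈ K) ∧ c 0 = 1 ∧
    (show GroupLieAlgebra 𝓘(ℝ, E) G from velocity (F := E) c 0) = a}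

/-- The left-invariant tensor field `C^L` on `G` with value `C` at `1`. -/
def leftTensor (C : GroupLieAlgebra 𝓘(ℝ, E) G ⊗[ℝ] GroupLieAlgebra 𝓘(ℝ, E) G) (g : G) :
    TangentSpace 𝓘(ℝ, E) g ⊗[ℝ] TangentSpace 𝓘(ℝ, E) g :=
  let dL : GroupLieAlgebra 𝓘(ℝ, E) G →ₗ[ℝ] TangentSpace 𝓘(ℝ, E) g :=
    (mfderiv 𝓘(ℝ, E) 𝓘(ℝ, E) (fun x : G => g * x) 1).toLinearMap
  TensorProduct.map dL dL C

/-- The right-invariant 1-form `α^R` on `G` with value `α` at `1`: the pullback of `α` by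
right translation by `g⁻¹`. -/
def rightForm (α : Module.Dual ℝ (GroupLieAlgebra 𝓘(ℝ, E) G)) (g : G) :
    Module.Dual ℝ (TangentSpace 𝓘(ℝ, E) g) :=
  let dR : TangentSpace 𝓘(ℝ, E) g →ₗ[ℝ] GroupLieAlgebra 𝓘(ℝ, E) G :=
    (mfderiv 𝓘(ℝ, E) 𝓘(ℝ, E) (fun x : G => x * g⁻¹) g).toLinearMap
  α ∘ₗ dR

/-- The horizontal vector field `C^L α^R` on `G`. -/
def horizontalField (C : GroupLieAlgebra 𝓘(ℝ, E) G ⊗[ℝ] GroupLieAlgebra 𝓘(ℝ, E) G)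
    (α : Module.Dual ℝ (GroupLieAlgebra 𝓘(ℝ, E) G)) (g : G) : TangentSpace 𝓘(ℝ, E) g :=
  contract (leftTensor C g) (rightForm α g)

end Group

/-! ### The homogeneous space -/

section Homogeneous

/-- The space of right cosets `K g`, with the quotient topology. -/
abbrev CosetSpace {G : Type*} [Group G] (K : Subgroup G) : Type _ :=
  Quotient (QuotientGroup.rightRel K)

/-- The canonical projection `g ↦ K g`. -/
def proj {G : Type*} [Group G] (K : Subgroup G) (g : G) : CosetSpace K :=
  Quotient.mk (QuotientGroup.rightRel K) g

theorem proj_mul_left {G : Type*} [Group G] {K : Subgroup G} {h : G} (hh : h ∈ K) (g : G) :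
    proj K (h * g) = proj K g := by
  refine Quotient.sound ?_
  change QuotientGroup.rightRel K (h * g) g
  rw [QuotientGroup.rightRel_apply]
  simpa using K.inv_mem hh

theorem proj_out {G : Type*} [Group G] {K : Subgroup G} (m : CosetSpace K) : proj K (Quotient.out m) = m :=
  Quotient.out_eq m

variable {E : Type*} [NormedAddCommGroup E] [NormedSpace ℝ E]
  {F : Type*} [NormedAddCommGroup F] [NormedSpace ℝ F]
  {G : Type*} [TopologicalSpace G] [ChartedSpace E G] [Group G]
  (K : Subgroup G) [ChartedSpace F (CosetSpace K)]

/-- The projection to `T_{K g} M` of a tangent vector of `G` at `g`. -/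
def projVector (g : G) (v : TangentSpace 𝓘(ℝ, E) g) : TangentSpace 𝓘(ℝ, F) (proj K g) :=
  mfderiv 𝓘(ℝ, E) 𝓘(ℝ, F) (proj K) g v

/-- The value at `K g` of the projected tensor `π_* (C^L)`, computed at the point `g` of the
fibre. -/
def projTensor (C : GroupLieAlgebra 𝓘(ℝ, E) G ⊗[ℝ] GroupLieAlgebra 𝓘(ℝ, E) G) (g : G) :
    TangentSpace 𝓘(ℝ, F) (proj K g) ⊗[ℝ] TangentSpace 𝓘(ℝ, F) (proj K g) :=
  let dπ : TangentSpace 𝓘(ℝ, E) g →ₗ[ℝ] TangentSpace 𝓘(ℝ, F) (proj K g) :=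
    (mfderiv 𝓘(ℝ, E) 𝓘(ℝ, F) (proj K) g).toLinearMap
  TensorProduct.map dπ dπ (leftTensor C g)

/-- The Lie-algebraic metric tensor `C^π = π_* (C^L)` on the coset space, computed at an arbitrary
point of each fibre (`metricTensor_proj` shows that the choice does not matter). -/
def metricTensor (C : GroupLieAlgebra 𝓘(ℝ, E) G ⊗[ℝ] GroupLieAlgebra 𝓘(ℝ, E) G)
    (m : CosetSpace K) : TangentSpace 𝓘(ℝ, F) m ⊗[ℝ] TangentSpace 𝓘(ℝ, F) m :=
  projTensor (F := F) K C (Quotient.out m)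

/-- `projTensor K C g` is the image of `C` under the differential at `1` of `x ↦ K g x`. -/
theorem projTensor_eq [LieGroup 𝓘(ℝ, E) ∞ G]
    (hπ : MDifferentiable 𝓘(ℝ, E) 𝓘(ℝ, F) (proj K))
    (C : GroupLieAlgebra 𝓘(ℝ, E) G ⊗[ℝ] GroupLieAlgebra 𝓘(ℝ, E) G) (g : G) :
    (show F ⊗[ℝ] F from projTensor (F := F) K C g) =
      TensorProduct.map
        (show E →ₗ[ℝ] F from
          (mfderiv 𝓘(ℝ, E) 𝓘(ℝ, F) (fun x : G => proj K (g * x)) 1).toLinearMap)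
        (show E →ₗ[ℝ] F from
          (mfderiv 𝓘(ℝ, E) 𝓘(ℝ, F) (fun x : G => proj K (g * x)) 1).toLinearMap)
        (show E ⊗[ℝ] E from C) := by
  have hL : MDifferentiableAt 𝓘(ℝ, E) 𝓘(ℝ, E) (fun x : G => g * x) 1 :=
    (contMDiff_mul_left (I := 𝓘(ℝ, E)) (n := ∞) (a := g)).mdifferentiable (by simp) 1
  have hcomp : (show E →L[ℝ] F from
        mfderiv 𝓘(ℝ, E) 𝓘(ℝ, F) (fun x : G => proj K (g * x)) 1) =
      (show E →L[ℝ] F from mfderiv 𝓘(ℝ, E) 𝓘(ℝ, F) (proj K) g).comp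
        (show E →L[ℝ] E from mfderiv 𝓘(ℝ, E) 𝓘(ℝ, E) (fun x : G => g * x) 1) := by
    have h := mfderiv_comp (I' := 𝓘(ℝ, E)) (1 : G) (hπ (g * 1)) hL
    rw [mul_one] at h
    exact h
  have hlin : (show E →ₗ[ℝ] F from
        (mfderiv 𝓘(ℝ, E) 𝓘(ℝ, F) (fun x : G => proj K (g * x)) 1).toLinearMap) =
      (show E →L[ℝ] F from mfderiv 𝓘(ℝ, E) 𝓘(ℝ, F) (proj K) g).toLinearMap ∘ₗ
        (show E →L[ℝ] E from
          mfderiv 𝓘(ℝ, E) 𝓘(ℝ, E) (fun x : G => g * x) 1).toLinearMap :=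
    congrArg ContinuousLinearMap.toLinearMap hcomp
  rw [hlin, TensorProduct.map_comp]
  rfl

theorem metricTensor_proj [LieGroup 𝓘(ℝ, E) ∞ G]
    (hπ : MDifferentiable 𝓘(ℝ, E) 𝓘(ℝ, F) (proj K))
    (C : GroupLieAlgebra 𝓘(ℝ, E) G ⊗[ℝ] GroupLieAlgebra 𝓘(ℝ, E) G) (g : G) :
    metricTensor (F := F) K C (proj K g) = projTensor (F := F) K C g := by
  have hfun : (fun x : G => proj K (Quotient.out (proj K g) * x)) =
      fun x : G => proj K (g * x) := by
    have hmem : Quotient.out (proj K g) * g⁻¹ ∈ K := by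
      have h : QuotientGroup.rightRel K g (Quotient.out (proj K g)) :=
        Setoid.symm' _ (Quotient.exact (proj_out (proj K g)))
      rwa [QuotientGroup.rightRel_apply] at h
    funext x
    rw [← proj_mul_left hmem (g * x)]
    group
  refine (projTensor_eq (F := F) K hπ C (Quotient.out (proj K g))).trans ?_
  refine Eq.trans ?_ (projTensor_eq (F := F) K hπ C g).symm
  rw [hfun]

end Homogeneous

end LieAlgebraicMetric

end

/-!
The argument is a computation with functions on `G` near a point `g`. Let `P` be the projection to
`K \ G` read in the preferred chart at `K g`, let `S : 𝔤* → 𝔤` be contraction with `C`, and let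
`T` be the metric tensor.

*The forms.* The form `α^R` takes constant values on right-invariant fields, and its values on
left-invariant fields form a map `x ↦ Ad*(x) α` with values in `𝔤*` (`rightFormLeft`). Hence `H^α`
is the combination of left-invariant fields with coefficient `S (Ad*(x) α)`
(`horizontalField_eq`). A vector tangent to a fibre of a submersion is the velocity of a curve in
the fibre, and the fibre `K g` is a right translate of `K`; so if `α` annihilates `𝔨`, then `α^R`
annihilates the vertical vectors (`rightForm_eq_zero`) and is the pullback of covectors of the
base. As `T` is the projection of `C^L`, these covectors are dual to `π_* H^α`: `⟨π_* H^α, π_* v⟩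
= α^R(v)` for all `v` (`metricInChart_horizontalDeriv`).

*The Koszul formula.* Write `U = π_* H^α`, `V = π_* H^β`, `W = π_* b^R`, where `b^R` is
right-invariant, all as functions on `G` with values in the model space of the base. Differentiate

* the constant `⟨V, W⟩ = β(b)` along `H^α`,
* the constant `⟨U, W⟩ = α(b)` along `H^β`,
* the function `⟨U, V⟩ = C(α^R, β^R)` along `b^R`,

and subtract the third identity from the sum of the first two. Left- and right-invariant fields
commute, since the derivatives along them are the two partial derivatives of `(s, t) ↦ f (s * x *
t)` (`tderiv_leftDeriv_rightTrans`). With the symmetry of `C`, all terms other than the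
derivatives of the metric and `H^α V + H^β U` cancel (`koszul_horizontalDeriv`). So the
Christoffel term is `Γ(U, V) = -½ (H^α V + H^β U)`, and `∇_{H^α} V = H^α V + Γ(U, V) = ½ (H^α V -
H^β U) = ½ π_* [H^α, H^β]`, the last step because a Lie bracket acts on functions as a commutator
(`tderiv_mlieBracket`).

*Geodesics.* For `α = β` the right-hand side vanishes. Integral curves of `H^α` are smooth
(`contMDiffAt_of_isMIntegralCurveOn`), and the chain rule turns `∇_{H^α} (π_* H^α) = 0` into the
geodesic equation for their projections.

That the metric is differentiable in a chart follows by inverting the contravariant metric, which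
is smooth because the submersion has smooth local sections (`contDiffAt_cometric`,
`contDiffAt_metricInChart`).
-/

noncomputable section

open Filter Topology

namespace LieAlgebraicMetric

/-! ### Derivatives as maps between model spaces -/

section Tderiv

variable {E : Type*} [NormedAddCommGroup E] [NormedSpace ℝ E]
  {E' : Type*} [NormedAddCommGroup E'] [NormedSpace ℝ E']
  {E'' : Type*} [NormedAddCommGroup E''] [NormedSpace ℝ E'']
  {M : Type*} [TopologicalSpace M] [ChartedSpace E M]
  {N : Type*} [TopologicalSpace N] [ChartedSpace E' N]
  {N' : Type*} [TopologicalSpace N'] [ChartedSpace E'' N']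

variable (E E') in
/-- The derivative of a map between manifolds, as a map between the model spaces: each tangent
space is identified with the model space through the preferred chart at its base point. -/
def tderiv (f : M → N) (x : M) : E →L[ℝ] E' :=
  mfderiv 𝓘(ℝ, E) 𝓘(ℝ, E') f x

theorem tderiv_comp {g : N → N'} {f : M → N} (x : M)
    (hg : MDifferentiableAt 𝓘(ℝ, E') 𝓘(ℝ, E'') g (f x))
    (hf : MDifferentiableAt 𝓘(ℝ, E) 𝓘(ℝ, E') f x) :
    tderiv E E'' (fun y => g (f y)) x = (tderiv E' E'' g (f x)).comp (tderiv E E' f x) :=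
  mfderiv_comp x hg hf

theorem tderiv_congr {f f₁ : M → N} {x : M} (h : f₁ =ᶠ[𝓝 x] f) :
    tderiv E E' f₁ x = tderiv E E' f x := by
  unfold tderiv
  exact h.mfderiv_eq (I := 𝓘(ℝ, E)) (I' := 𝓘(ℝ, E'))

theorem tderiv_eq_fderiv (f : E → E') (x : E) : tderiv E E' f x = fderiv ℝ f x :=
  mfderiv_eq_fderiv

theorem tderiv_extChartAt_self [IsManifold 𝓘(ℝ, E) 1 M] (x : M) :
    tderiv E E (extChartAt 𝓘(ℝ, E) x) x = ContinuousLinearMap.id ℝ E :=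
  mfderiv_extChartAt_self

theorem tderiv_extChartAt_symm_self [IsManifold 𝓘(ℝ, E) 1 M] (x : M) :
    tderiv E E (extChartAt 𝓘(ℝ, E) x).symm (extChartAt 𝓘(ℝ, E) x x) =
      ContinuousLinearMap.id ℝ E := by
  have h := mfderivWithin_range_extChartAt_symm (I := 𝓘(ℝ, E)) (x := x)
  rw [modelWithCornersSelf_coe, range_id, mfderivWithin_univ] at h
  exact h

theorem mdifferentiableAt_extChartAt_symm [IsManifold 𝓘(ℝ, E) 1 M] (x : M) {y : E}
    (hy : y ∈ (extChartAt 𝓘(ℝ, E) x).target) :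
    MDifferentiableAt 𝓘(ℝ, E) 𝓘(ℝ, E) (extChartAt 𝓘(ℝ, E) x).symm y := by
  have h := mdifferentiableWithinAt_extChartAt_symm (I := 𝓘(ℝ, E)) hy
  rwa [modelWithCornersSelf_coe, range_id, mdifferentiableWithinAt_univ] at h

theorem tderiv_extChartAt_comp_symm [IsManifold 𝓘(ℝ, E) 1 M] (x : M) {y : E}
    (hy : y ∈ (extChartAt 𝓘(ℝ, E) x).target) :
    (tderiv E E (extChartAt 𝓘(ℝ, E) x) ((extChartAt 𝓘(ℝ, E) x).symm y)).comp
      (tderiv E E (extChartAt 𝓘(ℝ, E) x).symm y) = ContinuousLinearMap.id ℝ E := by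
  have h := mfderiv_extChartAt_comp_mfderivWithin_extChartAt_symm (I := 𝓘(ℝ, E)) hy
  rw [modelWithCornersSelf_coe, range_id, mfderivWithin_univ] at h
  exact h

theorem tderiv_extChartAt_symm_comp [IsManifold 𝓘(ℝ, E) 1 M] (x : M) {y : E}
    (hy : y ∈ (extChartAt 𝓘(ℝ, E) x).target) :
    (tderiv E E (extChartAt 𝓘(ℝ, E) x).symm y).comp
      (tderiv E E (extChartAt 𝓘(ℝ, E) x) ((extChartAt 𝓘(ℝ, E) x).symm y)) =
        ContinuousLinearMap.id ℝ E := by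
  have h := mfderivWithin_extChartAt_symm_comp_mfderiv_extChartAt (I := 𝓘(ℝ, E)) hy
  rw [modelWithCornersSelf_coe, range_id, mfderivWithin_univ] at h
  exact h

theorem contMDiffAt_extChartAt_symm_self [IsManifold 𝓘(ℝ, E) ∞ M] (x : M) :
    ContMDiffAt 𝓘(ℝ, E) 𝓘(ℝ, E) ∞ (extChartAt 𝓘(ℝ, E) x).symm (extChartAt 𝓘(ℝ, E) x x) :=
  (contMDiffOn_extChartAt_symm (I := 𝓘(ℝ, E)) x).contMDiffAt
    (extChartAt_target_mem_nhds (I := 𝓘(ℝ, E)) x)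

/-- In the preferred chart at `x`, the derivative at `x` is the Fréchet derivative. -/
theorem tderiv_eq_fderiv_comp_symm [IsManifold 𝓘(ℝ, E) 1 M] {f : M → E'} {x : M}
    (hf : MDifferentiableAt 𝓘(ℝ, E) 𝓘(ℝ, E') f x) :
    tderiv E E' f x =
      fderiv ℝ (fun y => f ((extChartAt 𝓘(ℝ, E) x).symm y)) (extChartAt 𝓘(ℝ, E) x x) := by
  have h := tderiv_comp (g := f) (f := (extChartAt 𝓘(ℝ, E) x).symm) (extChartAt 𝓘(ℝ, E) x x)
    (by rwa [extChartAt_to_inv]) (mdifferentiableAt_extChartAt_symm x (mem_extChartAt_target x))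
  rw [tderiv_extChartAt_symm_self, extChartAt_to_inv, tderiv_eq_fderiv] at h
  rw [h]; rfl

theorem contMDiffAt_comp_extChartAt_symm [IsManifold 𝓘(ℝ, E) ∞ M] {f : M → E'} {x : M}
    {n : WithTop ℕ∞} (hn : n ≤ ∞) (hf : ContMDiffAt 𝓘(ℝ, E) 𝓘(ℝ, E') n f x) :
    ContDiffAt ℝ n (fun y => f ((extChartAt 𝓘(ℝ, E) x).symm y)) (extChartAt 𝓘(ℝ, E) x x) := by
  rw [← contMDiffAt_iff_contDiffAt]
  refine ContMDiffAt.comp (I' := 𝓘(ℝ, E)) (g := f) _ ?_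
    ((contMDiffAt_extChartAt_symm_self x).of_le hn)
  rwa [extChartAt_to_inv]

/-- Smoothness at `x` can be tested in the preferred chart at `x`. -/
theorem contMDiffAt_of_comp_extChartAt_symm [IsManifold 𝓘(ℝ, E) ∞ M] {f : M → E'} {x : M}
    {n : WithTop ℕ∞} (hn : n ≤ ∞)
    (hf : ContDiffAt ℝ n (fun y => f ((extChartAt 𝓘(ℝ, E) x).symm y)) (extChartAt 𝓘(ℝ, E) x x)) :
    ContMDiffAt 𝓘(ℝ, E) 𝓘(ℝ, E') n f x := by
  have h := ContMDiffAt.comp x hf.contMDiffAt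
    ((contMDiffAt_extChartAt (I := 𝓘(ℝ, E)) (n := ∞) (x := x)).of_le hn)
  refine h.congr_of_eventuallyEq ?_
  filter_upwards [extChartAt_source_mem_nhds (I := 𝓘(ℝ, E)) x] with z hz
  simp only [Function.comp]
  rw [(extChartAt 𝓘(ℝ, E) x).left_inv hz]

theorem contDiffAt_uncurry_comp_extChartAt_symm [IsManifold 𝓘(ℝ, E) ∞ M] [IsManifold 𝓘(ℝ, E') ∞ N]
    {Q : M → N → E''} {x : M} {z : N}
    (hQ : ContMDiffAt (𝓘(ℝ, E).prod 𝓘(ℝ, E')) 𝓘(ℝ, E'') ∞ (fun p : M × N => Q p.1 p.2) (x, z)) :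
    ContDiffAt ℝ ∞ (fun p : E × E' =>
      Q ((extChartAt 𝓘(ℝ, E) x).symm p.1) ((extChartAt 𝓘(ℝ, E') z).symm p.2))
      (extChartAt 𝓘(ℝ, E) x x, extChartAt 𝓘(ℝ, E') z z) := by
  rw [← contMDiffAt_iff_contDiffAt, modelWithCornersSelf_prod, ← chartedSpaceSelf_prod]
  have h1 : ContMDiffAt (𝓘(ℝ, E).prod 𝓘(ℝ, E')) (𝓘(ℝ, E).prod 𝓘(ℝ, E')) ∞
      (fun p : E × E' => ((extChartAt 𝓘(ℝ, E) x).symm p.1, (extChartAt 𝓘(ℝ, E') z).symm p.2))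
      (extChartAt 𝓘(ℝ, E) x x, extChartAt 𝓘(ℝ, E') z z) :=
    ((contMDiffAt_extChartAt_symm_self x).comp
        (extChartAt 𝓘(ℝ, E) x x, extChartAt 𝓘(ℝ, E') z z) contMDiffAt_fst).prodMk
      ((contMDiffAt_extChartAt_symm_self z).comp
        (extChartAt 𝓘(ℝ, E) x x, extChartAt 𝓘(ℝ, E') z z) contMDiffAt_snd)
  refine ContMDiffAt.comp (g := fun p : M × N => Q p.1 p.2)
    (extChartAt 𝓘(ℝ, E) x x, extChartAt 𝓘(ℝ, E') z z) ?_ h1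
  simpa only [extChartAt_to_inv] using hQ

/-- The partial derivatives of a smooth family at a base point are those of its coordinate
expression. -/
theorem eventually_tderiv_snd_eq [IsManifold 𝓘(ℝ, E) ∞ M] [IsManifold 𝓘(ℝ, E') ∞ N]
    {Q : M → N → E''} {x : M} {z : N}
    (hQ : ContMDiffAt (𝓘(ℝ, E).prod 𝓘(ℝ, E')) 𝓘(ℝ, E'') ∞ (fun p : M × N => Q p.1 p.2) (x, z)) :
    (fun y => tderiv E' E'' (Q ((extChartAt 𝓘(ℝ, E) x).symm y)) z)
      =ᶠ[𝓝 (extChartAt 𝓘(ℝ, E) x x)] fun y =>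
        (fderiv ℝ (fun p : E × E' =>
          Q ((extChartAt 𝓘(ℝ, E) x).symm p.1) ((extChartAt 𝓘(ℝ, E') z).symm p.2))
          (y, extChartAt 𝓘(ℝ, E') z z)).comp (ContinuousLinearMap.inr ℝ E E') := by
  have := IsManifold.of_le (M := N) (I := 𝓘(ℝ, E')) (m := 1) (n := ∞) (by simp)
  have h := ((contDiffAt_uncurry_comp_extChartAt_symm hQ).of_le
    (show (1 : WithTop ℕ∞) ≤ ∞ by simp)).eventually (by simp)
  have hc : ContinuousAt (fun y : E => (y, extChartAt 𝓘(ℝ, E') z z))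
      (extChartAt 𝓘(ℝ, E) x x) := by fun_prop
  filter_upwards [hc.eventually h] with y hy
  have h1 : ContDiffAt ℝ 1 (fun t : E' => Q ((extChartAt 𝓘(ℝ, E) x).symm y)
      ((extChartAt 𝓘(ℝ, E') z).symm t)) (extChartAt 𝓘(ℝ, E') z z) :=
    ContDiffAt.comp (f := fun t : E' => (y, t)) _ hy (by fun_prop)
  have h2 := (contMDiffAt_of_comp_extChartAt_symm (n := 1) (by simp) h1).mdifferentiableAt
    (by simp)
  rw [tderiv_eq_fderiv_comp_symm h2]
  exact ((hy.differentiableAt (by simp)).hasFDerivAt.comp _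
    (hasFDerivAt_prodMk_right y (extChartAt 𝓘(ℝ, E') z z))).fderiv

/-- The partial derivative in the second variable of a smooth family is smooth. -/
theorem contMDiffAt_tderiv_snd [IsManifold 𝓘(ℝ, E) ∞ M] [IsManifold 𝓘(ℝ, E') ∞ N]
    {Q : M → N → E''} {x : M} {z : N}
    (hQ : ContMDiffAt (𝓘(ℝ, E).prod 𝓘(ℝ, E')) 𝓘(ℝ, E'') ∞ (fun p : M × N => Q p.1 p.2) (x, z)) :
    ContMDiffAt 𝓘(ℝ, E) 𝓘(ℝ, E' →L[ℝ] E'') ∞ (fun y => tderiv E' E'' (Q y) z) x := by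
  refine contMDiffAt_of_comp_extChartAt_symm le_rfl
    (ContDiffAt.congr_of_eventuallyEq ?_ (eventually_tderiv_snd_eq hQ))
  have h3 := (contDiffAt_uncurry_comp_extChartAt_symm hQ).fderiv_right
    (show (∞ : WithTop ℕ∞) + 1 ≤ ∞ by simp)
  exact (ContDiffAt.comp (f := fun y : E => (y, extChartAt 𝓘(ℝ, E') z z)) _ h3
    (by fun_prop)).clm_comp contDiffAt_const

/-- Mixed partial derivatives of a smooth family are second derivatives of its coordinate
expression. -/
theorem tderiv_tderiv_snd_eq [IsManifold 𝓘(ℝ, E) ∞ M] [IsManifold 𝓘(ℝ, E') ∞ N]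
    {Q : M → N → E''} {x : M} {z : N}
    (hQ : ContMDiffAt (𝓘(ℝ, E).prod 𝓘(ℝ, E')) 𝓘(ℝ, E'') ∞ (fun p : M × N => Q p.1 p.2) (x, z))
    (b : E) (v : E') :
    tderiv E (E' →L[ℝ] E'') (fun y => tderiv E' E'' (Q y) z) x b v =
      fderiv ℝ (fderiv ℝ (fun p : E × E' =>
          Q ((extChartAt 𝓘(ℝ, E) x).symm p.1) ((extChartAt 𝓘(ℝ, E') z).symm p.2)))
        (extChartAt 𝓘(ℝ, E) x x, extChartAt 𝓘(ℝ, E') z z) (b, 0) (0, v) := by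
  have := IsManifold.of_le (M := M) (I := 𝓘(ℝ, E)) (m := 1) (n := ∞) (by simp)
  rw [tderiv_eq_fderiv_comp_symm ((contMDiffAt_tderiv_snd hQ).mdifferentiableAt (by simp)),
    (eventually_tderiv_snd_eq hQ).fderiv_eq]
  have h3 := ((contDiffAt_uncurry_comp_extChartAt_symm hQ).fderiv_right
    (show (∞ : WithTop ℕ∞) + 1 ≤ ∞ by simp)).differentiableAt (by simp)
  have h4 := h3.hasFDerivAt.comp (f := fun y : E => (y, extChartAt 𝓘(ℝ, E') z z)) _
    (hasFDerivAt_prodMk_left (extChartAt 𝓘(ℝ, E) x x) (extChartAt 𝓘(ℝ, E') z z))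
  have h5 := h4.clm_comp (hasFDerivAt_const (ContinuousLinearMap.inr ℝ E E') _)
  erw [h5.fderiv]
  simp

/-- Mixed partial derivatives of a smooth family commute. -/
theorem tderiv_tderiv_comm [IsManifold 𝓘(ℝ, E) ∞ M] [IsManifold 𝓘(ℝ, E') ∞ N]
    {Q : M → N → E''} {x : M} {z : N}
    (hQ : ContMDiffAt (𝓘(ℝ, E).prod 𝓘(ℝ, E')) 𝓘(ℝ, E'') ∞ (fun p : M × N => Q p.1 p.2) (x, z))
    (b : E) (v : E') :
    tderiv E (E' →L[ℝ] E'') (fun y => tderiv E' E'' (Q y) z) x b v =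
      tderiv E' (E →L[ℝ] E'') (fun t => tderiv E E'' (fun y => Q y t) x) z v b := by
  have hQ' : ContMDiffAt (𝓘(ℝ, E').prod 𝓘(ℝ, E)) 𝓘(ℝ, E'') ∞
      (fun p : N × M => Q p.2 p.1) (z, x) :=
    ContMDiffAt.comp (g := fun p : M × N => Q p.1 p.2) (z, x) hQ
      (contMDiffAt_snd.prodMk contMDiffAt_fst)
  rw [tderiv_tderiv_snd_eq hQ, tderiv_tderiv_snd_eq (Q := fun t y => Q y t) hQ']
  have hG := contDiffAt_uncurry_comp_extChartAt_symm hQ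
  set e := extChartAt 𝓘(ℝ, E) x x
  set e' := extChartAt 𝓘(ℝ, E') z z
  set Qc := fun p : E × E' =>
    Q ((extChartAt 𝓘(ℝ, E) x).symm p.1) ((extChartAt 𝓘(ℝ, E') z).symm p.2)
  let s := ContinuousLinearEquiv.prodComm ℝ E' E
  have hs : (fun p : E' × E =>
      Q ((extChartAt 𝓘(ℝ, E) x).symm p.2) ((extChartAt 𝓘(ℝ, E') z).symm p.1)) = Qc ∘ s := rfl
  rw [hs, hG.isSymmSndFDerivAt
    (by rw [minSmoothness_of_isRCLikeNormedField]; exact WithTop.coe_le_coe.2 le_top) (b, 0) (0, v)]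
  have h1 : fderiv ℝ (Qc ∘ s) = fun p => (fderiv ℝ Qc (s p)).comp (s : E' × E →L[ℝ] E × E') := by
    funext p
    exact s.comp_right_fderiv
  have h2 : HasFDerivAt (fderiv ℝ Qc) (fderiv ℝ (fderiv ℝ Qc) (e, e')) (s (e', e)) :=
    ((hG.fderiv_right (show (∞ : WithTop ℕ∞) + 1 ≤ ∞ by simp)).differentiableAt
      (by simp)).hasFDerivAt
  have h3 := (h2.comp (e', e) s.hasFDerivAt).clm_comp
    (hasFDerivAt_const (s : E' × E →L[ℝ] E × E') (e', e))
  rw [h1]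
  erw [h3.fderiv]
  simp [s]

end Tderiv

/-! ### Contraction with contravariant tensors -/

section Sharp

variable {V W : Type*} [AddCommGroup V] [Module ℝ V] [AddCommGroup W] [Module ℝ W]

theorem contract_add (S T : V ⊗[ℝ] V) (ξ : Module.Dual ℝ V) :
    contract (S + T) ξ = contract S ξ + contract T ξ := by
  simp [contract]

theorem contract_map (D : V →ₗ[ℝ] W) (T : V ⊗[ℝ] V) (ξ : Module.Dual ℝ W) :
    contract (TensorProduct.map D D T) ξ = D (contract T (ξ ∘ₗ D)) := by
  induction T with
  | zero => simp [contract]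
  | tmul a b => simp
  | add S T hS hT =>
    rw [map_add, contract_add, contract_add, hS, hT, map_add]

theorem contract_comm (T : V ⊗[ℝ] V) (ξ η : Module.Dual ℝ V) :
    ξ (contract (TensorProduct.comm ℝ V V T) η) = η (contract T ξ) := by
  induction T with
  | zero => simp [contract]
  | tmul a b => simp [mul_comm]
  | add S T hS hT =>
    rw [map_add, contract_add, contract_add, map_add, map_add, hS, hT]

variable {E : Type*} [NormedAddCommGroup E] [NormedSpace ℝ E] [FiniteDimensional ℝ E]
  {F : Type*} [NormedAddCommGroup F] [NormedSpace ℝ F] [FiniteDimensional ℝ F]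

/-- Contraction with a contravariant tensor, as a continuous map on the continuous dual. -/
def sharp (T : E ⊗[ℝ] E) : (E →L[ℝ] ℝ) →L[ℝ] E :=
  LinearMap.toContinuousLinearMap (contract T ∘ₗ ContinuousLinearMap.coeLM ℝ)

theorem sharp_apply (T : E ⊗[ℝ] E) (ξ : E →L[ℝ] ℝ) :
    sharp T ξ = contract T (ξ : E →ₗ[ℝ] ℝ) := rfl

theorem sharp_map (D : E →L[ℝ] F) (T : E ⊗[ℝ] E) (ξ : F →L[ℝ] ℝ) :
    sharp (TensorProduct.map (D : E →ₗ[ℝ] F) (D : E →ₗ[ℝ] F) T) ξ = D (sharp T (ξ.comp D)) :=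
  contract_map _ _ _

theorem sharp_symm {T : E ⊗[ℝ] E} (hT : TensorProduct.comm ℝ E E T = T) (ξ η : E →L[ℝ] ℝ) :
    ξ (sharp T η) = η (sharp T ξ) := by
  have h := contract_comm T (ξ : E →ₗ[ℝ] ℝ) (η : E →ₗ[ℝ] ℝ)
  rw [hT] at h
  exact h

theorem nondegenerate_iff_bijective_sharp (T : E ⊗[ℝ] E) :
    Nondegenerate T ↔ Function.Bijective (sharp T) :=
  (Function.Bijective.of_comp_iff (contract T)
    (LinearMap.toContinuousLinearMap (𝕜 := ℝ) (E := E) (F' := ℝ)).symm.bijective).symm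

theorem covariantForm_sharp {T : E ⊗[ℝ] E} (hT : Nondegenerate T) (ξ : E →L[ℝ] ℝ) (v : E) :
    covariantForm T (sharp T ξ) v = ξ v := by
  have h : (LinearEquiv.ofBijective (contract T) hT).symm (contract T (ξ : E →ₗ[ℝ] ℝ)) =
      (ξ : E →ₗ[ℝ] ℝ) := (LinearEquiv.ofBijective (contract T) hT).symm_apply_apply _
  rw [sharp_apply, covariantForm, dif_pos hT]
  exact congrArg (fun l : E →ₗ[ℝ] ℝ => l v) h

end Sharp

/-! ### Derivatives along left- and right-invariant vector fields -/

section Group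

variable {E : Type*} [NormedAddCommGroup E] [NormedSpace ℝ E]
  {H : Type*} [NormedAddCommGroup H] [NormedSpace ℝ H]
  {G : Type*} [TopologicalSpace G] [ChartedSpace E G] [Group G]

variable (E) in
/-- The derivative of `f` at `x` along all left-invariant vector fields, as a linear function of
their value at `1`. -/
def leftDeriv (f : G → H) (x : G) : E →L[ℝ] H := tderiv E H (fun t => f (x * t)) 1

variable (E) in
/-- The derivative of `f` at `x` along all right-invariant vector fields, as a linear function of
their value at `1`. -/
def rightDeriv (f : G → H) (x : G) : E →L[ℝ] H := tderiv E H (fun s => f (s * x)) 1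

variable (E) in
/-- The differential at `1` of the left translation by `x`. -/
def leftTrans (x : G) : E →L[ℝ] E := tderiv E E (fun t => x * t) 1

variable (E) in
/-- The differential at `1` of the right translation by `x`. -/
def rightTrans (x : G) : E →L[ℝ] E := tderiv E E (fun s => s * x) 1

/-- The values on the left-invariant vector fields at `x` of the right-invariant form with value
`α` at `1`; this is the coadjoint action of `x` on `α`. -/
def rightFormLeft (α : E →L[ℝ] ℝ) (x : G) : E →L[ℝ] ℝ :=
  α.comp (tderiv E E (fun t => x * t * x⁻¹) 1)

variable [LieGroup 𝓘(ℝ, E) ∞ G]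

theorem mdifferentiableAt_mul_left (x y : G) :
    MDifferentiableAt 𝓘(ℝ, E) 𝓘(ℝ, E) (fun t : G => x * t) y :=
  (contMDiff_mul_left (I := 𝓘(ℝ, E)) (n := ∞) (a := x)).mdifferentiable (by simp) y

theorem mdifferentiableAt_mul_right (x y : G) :
    MDifferentiableAt 𝓘(ℝ, E) 𝓘(ℝ, E) (fun t : G => t * x) y :=
  (contMDiff_mul_right (I := 𝓘(ℝ, E)) (n := ∞) (a := x)).mdifferentiable (by simp) y

theorem leftDeriv_eq {f : G → H} {x : G} (hf : MDifferentiableAt 𝓘(ℝ, E) 𝓘(ℝ, H) f x) :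
    leftDeriv E f x = (tderiv E H f x).comp (leftTrans E x) := by
  have h := tderiv_comp (g := f) (f := fun t => x * t) 1 (by rwa [mul_one])
    (mdifferentiableAt_mul_left (E := E) x 1)
  rwa [mul_one] at h

theorem rightDeriv_eq {f : G → H} {x : G} (hf : MDifferentiableAt 𝓘(ℝ, E) 𝓘(ℝ, H) f x) :
    rightDeriv E f x = (tderiv E H f x).comp (rightTrans E x) := by
  have h := tderiv_comp (g := f) (f := fun t => t * x) 1 (by rwa [one_mul])
    (mdifferentiableAt_mul_right (E := E) x 1)
  rwa [one_mul] at h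

theorem rightTrans_surjective (x : G) : Function.Surjective (rightTrans E x) := by
  have h := tderiv_comp (g := fun t => t * x) (f := fun t => t * x⁻¹) x
    (mdifferentiableAt_mul_right (E := E) x (x * x⁻¹)) (mdifferentiableAt_mul_right (E := E) x⁻¹ x)
  have h1 : tderiv E E (fun t : G => t) x = ContinuousLinearMap.id ℝ E :=
    mfderiv_id (I := 𝓘(ℝ, E))
  simp only [inv_mul_cancel_right, mul_inv_cancel, h1] at h
  exact fun v => ⟨_, (DFunLike.congr_fun h v).symm⟩

theorem contMDiffAt_leftDeriv {f : G → H} {x : G} (hf : ContMDiffAt 𝓘(ℝ, E) 𝓘(ℝ, H) ∞ f x) :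
    ContMDiffAt 𝓘(ℝ, E) 𝓘(ℝ, E →L[ℝ] H) ∞ (leftDeriv E f) x := by
  have := LieGroup.toContMDiffMul (I := 𝓘(ℝ, E)) (n := ∞) (G := G)
  have := this.toIsManifold
  refine contMDiffAt_tderiv_snd (Q := fun x t => f (x * t)) (ContMDiffAt.comp (g := f) (x, 1)
    (by simpa using hf) (contMDiff_mul 𝓘(ℝ, E) ∞ (x, 1)))

theorem contMDiffAt_rightDeriv {f : G → H} {x : G} (hf : ContMDiffAt 𝓘(ℝ, E) 𝓘(ℝ, H) ∞ f x) :
    ContMDiffAt 𝓘(ℝ, E) 𝓘(ℝ, E →L[ℝ] H) ∞ (rightDeriv E f) x := by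
  have := LieGroup.toContMDiffMul (I := 𝓘(ℝ, E)) (n := ∞) (G := G)
  have := this.toIsManifold
  refine contMDiffAt_tderiv_snd (Q := fun x t => f (t * x)) (ContMDiffAt.comp (g := f) (x, 1)
    (by simpa using hf) ((contMDiffAt_snd (p := (x, (1 : G)))).mul contMDiffAt_fst))

/-- Left-invariant and right-invariant vector fields commute: derivatives along them are the two
partial derivatives of `(s, t) ↦ f (s * x * t)`. -/
theorem tderiv_leftDeriv_rightTrans {f : G → H} {x : G}
    (hf : ContMDiffAt 𝓘(ℝ, E) 𝓘(ℝ, H) ∞ f x) (b v : E) :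
    tderiv E (E →L[ℝ] H) (leftDeriv E f) x (rightTrans E x b) v =
      tderiv E (E →L[ℝ] H) (rightDeriv E f) x (leftTrans E x v) b := by
  have := LieGroup.toContMDiffMul (I := 𝓘(ℝ, E)) (n := ∞) (G := G)
  have := this.toIsManifold
  have hQ : ContMDiffAt (𝓘(ℝ, E).prod 𝓘(ℝ, E)) 𝓘(ℝ, H) ∞
      (fun p : G × G => f (p.1 * x * p.2)) (1, 1) :=
    ContMDiffAt.comp (g := f) (1, 1) (by simpa using hf)
      ((contMDiffAt_fst.mul contMDiffAt_const).mul contMDiffAt_snd)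
  have h := tderiv_tderiv_comm (Q := fun s t => f (s * x * t)) hQ b v
  have h1 := rightDeriv_eq ((contMDiffAt_leftDeriv hf).mdifferentiableAt (by simp))
  have h2 := leftDeriv_eq ((contMDiffAt_rightDeriv hf).mdifferentiableAt (by simp))
  rw [← ContinuousLinearMap.comp_apply, ← h1, ← ContinuousLinearMap.comp_apply, ← h2]
  simp only [rightDeriv, leftDeriv, mul_assoc] at h ⊢
  exact h

theorem contMDiffAt_rightFormLeft (α : E →L[ℝ] ℝ) (x : G) :
    ContMDiffAt 𝓘(ℝ, E) 𝓘(ℝ, E →L[ℝ] ℝ) ∞ (rightFormLeft α) x := by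
  have := LieGroup.toContMDiffMul (I := 𝓘(ℝ, E)) (n := ∞) (G := G)
  have := this.toIsManifold
  have := IsManifold.of_le (M := G) (I := 𝓘(ℝ, E)) (m := 1) (n := ∞) (by simp)
  -- conjugation by `x` fixes `1`, where the derivative of the chart at `1` is the identity
  have hQ : ContMDiffAt (𝓘(ℝ, E).prod 𝓘(ℝ, E)) 𝓘(ℝ, E) ∞
      (fun p : G × G => extChartAt 𝓘(ℝ, E) (1 : G) (p.1 * p.2 * p.1⁻¹)) (x, 1) :=
    ContMDiffAt.comp (g := extChartAt 𝓘(ℝ, E) (1 : G)) (x, 1)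
      (by
      rw [mul_one, mul_inv_cancel]
      exact contMDiffAt_extChartAt)
      ((contMDiffAt_fst.mul contMDiffAt_snd).mul contMDiffAt_fst.inv)
  have h := contMDiffAt_tderiv_snd (Q := fun x t => extChartAt 𝓘(ℝ, E) (1 : G) (x * t * x⁻¹)) hQ
  have h1 : rightFormLeft α = fun x : G =>
      ContinuousLinearMap.compL ℝ E E ℝ α
        (tderiv E E (fun t => extChartAt 𝓘(ℝ, E) (1 : G) (x * t * x⁻¹)) 1) := by
    funext x
    have h2 : MDifferentiableAt 𝓘(ℝ, E) 𝓘(ℝ, E) (fun t : G => x * t * x⁻¹) 1 :=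
      MDifferentiableAt.comp (g := fun t : G => t * x⁻¹) 1
        (mdifferentiableAt_mul_right (E := E) x⁻¹ _)
        (mdifferentiableAt_mul_left (E := E) x 1)
    have h3 := tderiv_comp (g := extChartAt 𝓘(ℝ, E) (1 : G)) (f := fun t : G => x * t * x⁻¹) 1
      (by simpa using mdifferentiableAt_extChartAt (I := 𝓘(ℝ, E)) (mem_chart_source E (1 : G))) h2
    simp only [mul_one, mul_inv_cancel, tderiv_extChartAt_self] at h3
    rw [h3]
    rfl
  rw [h1]
  exact (ContinuousLinearMap.compL ℝ E E ℝ α).contMDiff.contMDiffAt.comp x h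

theorem rightForm_rightTrans (α : Module.Dual ℝ (GroupLieAlgebra 𝓘(ℝ, E) G)) (x : G) (v : E) :
    rightForm α x (rightTrans E x v) = α v := by
  have h := tderiv_comp (g := fun t : G => t * x⁻¹) (f := fun t => t * x) 1
      (mdifferentiableAt_mul_right (E := E) x⁻¹ _) (mdifferentiableAt_mul_right (E := E) x 1)
  have h1 : tderiv E E (fun t : G => t) 1 = ContinuousLinearMap.id ℝ E :=
    mfderiv_id (I := 𝓘(ℝ, E))
  simp only [mul_inv_cancel_right, one_mul, h1] at h
  exact congrArg (show E →ₗ[ℝ] ℝ from α) (DFunLike.congr_fun h v).symm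

variable [FiniteDimensional ℝ E]

theorem rightForm_leftTrans (α : Module.Dual ℝ (GroupLieAlgebra 𝓘(ℝ, E) G)) (x : G) (v : E) :
    rightForm α x (leftTrans E x v) =
      rightFormLeft (LinearMap.toContinuousLinearMap (show E →ₗ[ℝ] ℝ from α)) x v := by
  have h := tderiv_comp (g := fun t : G => t * x⁻¹) (f := fun t => x * t) 1
      (mdifferentiableAt_mul_right (E := E) x⁻¹ _) (mdifferentiableAt_mul_left (E := E) x 1)
  rw [mul_one] at h
  rw [rightFormLeft, h]
  rfl

/-- The horizontal field of `α` is the left-invariant field whose value at `1` varies with the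
coadjoint action on `α`. -/
theorem horizontalField_eq (C : GroupLieAlgebra 𝓘(ℝ, E) G ⊗[ℝ] GroupLieAlgebra 𝓘(ℝ, E) G)
    (α : Module.Dual ℝ (GroupLieAlgebra 𝓘(ℝ, E) G)) (x : G) :
    (show E from horizontalField C α x) = leftTrans E x (sharp (show E ⊗[ℝ] E from C)
      (rightFormLeft (LinearMap.toContinuousLinearMap (show E →ₗ[ℝ] ℝ from α)) x)) := by
  have h := contract_map (leftTrans E x : E →ₗ[ℝ] E) (show E ⊗[ℝ] E from C)
    (show E →ₗ[ℝ] ℝ from rightForm α x)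
  have h1 : (show E →ₗ[ℝ] ℝ from rightForm α x) ∘ₗ (leftTrans E x : E →ₗ[ℝ] E) =
      rightFormLeft (LinearMap.toContinuousLinearMap (show E →ₗ[ℝ] ℝ from α)) x :=
    LinearMap.ext (rightForm_leftTrans α x)
  rw [h1] at h
  exact h

end Group

/-! ### Local structure of a submersion -/

section Submersion

variable {E : Type*} [NormedAddCommGroup E] [NormedSpace ℝ E]
  {F : Type*} [NormedAddCommGroup F] [NormedSpace ℝ F]
  {M : Type*} [TopologicalSpace M] [ChartedSpace E M]
  {N : Type*} [TopologicalSpace N] [ChartedSpace F N]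

theorem _root_.Manifold.IsSubmersionAtOfComplement.codChart_comp_symm
    {W : Type*} [NormedAddCommGroup W] [NormedSpace ℝ W] {f : M → N} {x : M}
    (h : IsSubmersionAtOfComplement W 𝓘(ℝ, E) 𝓘(ℝ, F) ∞ f x) {y : E}
    (hy : y ∈ h.domChart.target) :
    h.codChart (f (h.domChart.symm y)) = (h.equiv y).1 := by
  have h1 := h.writtenInCharts
    (show y ∈ (h.domChart.extend 𝓘(ℝ, E)).target by simpa using hy)
  simpa using h1

/-- A submersion has smooth local sections; here, as a function of the coordinates on the base. -/
theorem exists_section_of_isSubmersionAt [IsManifold 𝓘(ℝ, F) ∞ N] {f : M → N} {x : M}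
    (hf : IsSubmersionAt 𝓘(ℝ, E) 𝓘(ℝ, F) ∞ f x) :
    ∃ σ : F → M, ContMDiffAt 𝓘(ℝ, F) 𝓘(ℝ, E) ∞ σ (extChartAt 𝓘(ℝ, F) (f x) (f x)) ∧
      σ (extChartAt 𝓘(ℝ, F) (f x) (f x)) = x ∧
      ∀ᶠ y in 𝓝 (extChartAt 𝓘(ℝ, F) (f x) (f x)),
        f (σ y) = (extChartAt 𝓘(ℝ, F) (f x)).symm y := by
  obtain ⟨W, _, _, h⟩ := hf
  set χ := h.domChart
  set κ := h.codChart
  set φ := extChartAt 𝓘(ℝ, F) (f x)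
  have hx := h.mem_domChart_source
  have hfx := h.mem_codChart_source
  have hnf : ∀ y ∈ χ.target, κ (f (χ.symm y)) = (h.equiv y).1 := fun y hy => h.codChart_comp_symm hy
  let ρ : F → E := fun y => h.equiv.symm (κ (φ.symm y), (h.equiv (χ x)).2)
  have hsymm : φ.symm (φ (f x)) = f x := extChartAt_to_inv (f x)
  have hρ0 : ρ (φ (f x)) = χ x := by
    have h1 : κ (f x) = (h.equiv (χ x)).1 := by
      simpa [χ.left_inv hx] using hnf (χ x) (χ.map_source hx)
    simp only [ρ, hsymm, h1]
    simp
  have hφs := contMDiffAt_extChartAt_symm_self (E := F) (f x)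
  have hρ : ContMDiffAt 𝓘(ℝ, F) 𝓘(ℝ, E) ∞ ρ (φ (f x)) := by
    have h1 : ContMDiffAt 𝓘(ℝ, F) 𝓘(ℝ, F) ∞ (fun y => κ (φ.symm y)) (φ (f x)) :=
      ContMDiffAt.comp (g := κ) _
        (contMDiffAt_of_mem_maximalAtlas h.codChart_mem_maximalAtlas (by rwa [hsymm])) hφs
    rw [contMDiffAt_iff_contDiffAt] at h1 ⊢
    exact h.equiv.symm.contDiff.contDiffAt.comp _ (h1.prodMk contDiffAt_const)
  refine ⟨fun y => χ.symm (ρ y), ?_, ?_, ?_⟩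
  · refine ContMDiffAt.comp (g := χ.symm) _
      (contMDiffAt_symm_of_mem_maximalAtlas h.domChart_mem_maximalAtlas ?_) hρ
    rw [hρ0]
    exact χ.map_source hx
  · change χ.symm (ρ (φ (f x))) = x
    rw [hρ0, χ.left_inv hx]
  · have h1 : ∀ᶠ y in 𝓝 (φ (f x)), ρ y ∈ χ.target :=
      hρ.continuousAt.eventually_mem (χ.open_target.mem_nhds (hρ0 ▸ χ.map_source hx))
    have h2 : ∀ᶠ y in 𝓝 (φ (f x)), φ.symm y ∈ κ.source :=
      hφs.continuousAt.eventually_mem (κ.open_source.mem_nhds (by rwa [hsymm]))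
    filter_upwards [h1, h2] with y hy1 hy2
    refine κ.injOn (h.source_subset_preimage_source (χ.map_target hy1)) hy2 ?_
    rw [hnf _ hy1]
    simp [ρ]

/-- Every vector tangent to a fibre of a submersion is the velocity of a smooth curve lying in the
fibre. -/
theorem exists_curve_of_tderiv_eq_zero {f : M → N} {x : M}
    [IsManifold 𝓘(ℝ, E) ∞ M] [IsManifold 𝓘(ℝ, F) ∞ N]
    (hf : IsSubmersionAt 𝓘(ℝ, E) 𝓘(ℝ, F) ∞ f x) {v : E} (hv : tderiv E F f x v = 0) :
    ∃ (ε : ℝ) (c : ℝ → M), 0 < ε ∧ ContMDiffOn 𝓘(ℝ, ℝ) 𝓘(ℝ, E) ∞ c (Ioo (-ε) ε) ∧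
      (∀ t ∈ Ioo (-ε) ε, f (c t) = f x) ∧ c 0 = x ∧ tderiv ℝ E c 0 1 = v := by
  obtain ⟨W, _, _, h⟩ := hf
  have := IsManifold.of_le (M := M) (I := 𝓘(ℝ, E)) (m := 1) (n := ∞) (by simp)
  set χ := h.domChart
  set κ := h.codChart
  have hx := h.mem_domChart_source
  have hfx := h.mem_codChart_source
  have hnf : ∀ y ∈ χ.target, κ (f (χ.symm y)) = (h.equiv y).1 := fun y hy => h.codChart_comp_symm hy
  have hχ : MDifferentiableAt 𝓘(ℝ, E) 𝓘(ℝ, E) χ x :=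
    (contMDiffAt_of_mem_maximalAtlas h.domChart_mem_maximalAtlas hx).mdifferentiableAt (by simp)
  have hχs : ContMDiffOn 𝓘(ℝ, E) 𝓘(ℝ, E) ∞ χ.symm χ.target :=
    contMDiffOn_symm_of_mem_maximalAtlas h.domChart_mem_maximalAtlas
  have hχs' : MDifferentiableAt 𝓘(ℝ, E) 𝓘(ℝ, E) χ.symm (χ x) :=
    (hχs.contMDiffAt (χ.open_target.mem_nhds (χ.map_source hx))).mdifferentiableAt (by simp)
  set w := tderiv E E χ x v
  -- the coordinate expression of `f` is linear, so `w` is tangent to a line in the fibre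
  have hw : (h.equiv w).1 = 0 := by
    have h1 : (fun z => κ (f z)) =ᶠ[𝓝 x] fun z => (h.equiv (χ z)).1 := by
      filter_upwards [χ.open_source.mem_nhds hx] with z hz
      simpa [χ.left_inv hz] using hnf (χ z) (χ.map_source hz)
    have h2 := tderiv_comp (g := κ) (f := f) x
      ((contMDiffAt_of_mem_maximalAtlas h.codChart_mem_maximalAtlas hfx).mdifferentiableAt
        (by simp)) (h.contMDiffAt.mdifferentiableAt (by simp))
    have h3 := tderiv_comp
      (g := (ContinuousLinearMap.fst ℝ F W).comp (h.equiv : E →L[ℝ] F × W)) (f := χ) x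
      (ContinuousLinearMap.differentiableAt _).mdifferentiableAt hχ
    rw [tderiv_eq_fderiv, ContinuousLinearMap.fderiv] at h3
    have h4 := DFunLike.congr_fun (h2.symm.trans ((tderiv_congr h1).trans h3)) v
    simpa [hv] using h4.symm
  have hline : ContDiff ℝ ∞ (fun t : ℝ => χ x + t • w) := by fun_prop
  have hmem : ∀ᶠ t in 𝓝 (0 : ℝ), χ x + t • w ∈ χ.target :=
    hline.continuous.continuousAt.eventually_mem
      (χ.open_target.mem_nhds (by simpa using χ.map_source hx))
  obtain ⟨ε, hε, hball⟩ := Metric.eventually_nhds_iff_ball.1 hmem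
  rw [Real.ball_eq_Ioo, zero_sub, zero_add] at hball
  refine ⟨ε, fun t => χ.symm (χ x + t • w), hε, ?_, ?_, ?_, ?_⟩
  · exact hχs.comp hline.contMDiff.contMDiffOn hball
  · intro t ht
    refine κ.injOn (h.source_subset_preimage_source (χ.map_target (hball t ht))) hfx ?_
    have h1 := hnf (χ x) (χ.map_source hx)
    rw [χ.left_inv hx] at h1
    rw [hnf _ (hball t ht), h1]
    simp [hw]
  · simpa using χ.left_inv hx
  · have h1 := tderiv_comp (g := χ.symm) (f := fun t : ℝ => χ x + t • w) 0
      (by simpa using hχs') (hline.differentiable (by simp) 0).mdifferentiableAt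
    have h2 : HasFDerivAt (fun t : ℝ => χ x + t • w)
        ((1 : ℝ →L[ℝ] ℝ).smulRight w) 0 :=
      (((1 : ℝ →L[ℝ] ℝ).smulRight w).hasFDerivAt).const_add _
    have h3 := tderiv_comp (g := χ.symm) (f := χ) x hχs' hχ
    have h4 : (fun z => χ.symm (χ z)) =ᶠ[𝓝 x] id := by
      filter_upwards [χ.open_source.mem_nhds hx] with z hz using χ.left_inv hz
    have h5 : tderiv E E (id : M → M) x = ContinuousLinearMap.id ℝ E :=
      mfderiv_id (I := 𝓘(ℝ, E))
    rw [tderiv_congr h4, h5] at h3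
    have h6 := DFunLike.congr_fun h3 v
    rw [h1, tderiv_eq_fderiv, h2.fderiv]
    simpa using h6.symm

end Submersion

theorem mul_inv_mem_of_proj_eq {G : Type*} [Group G] {K : Subgroup G} {x y : G}
    (h : proj K x = proj K y) : x * y⁻¹ ∈ K := by
  have h1 : QuotientGroup.rightRel K y x := Quotient.exact h.symm
  rwa [QuotientGroup.rightRel_apply] at h1

/-! ### Covectors annihilating the Lie algebra of the subgroup -/

section Annihilator

variable {E : Type*} [NormedAddCommGroup E] [NormedSpace ℝ E]
  {F : Type*} [NormedAddCommGroup F] [NormedSpace ℝ F]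
  {G : Type*} [TopologicalSpace G] [ChartedSpace E G] [Group G] [LieGroup 𝓘(ℝ, E) ∞ G]
  {K : Subgroup G} [ChartedSpace F (CosetSpace K)] [IsManifold 𝓘(ℝ, F) ∞ (CosetSpace K)]

/-- If `α` annihilates the Lie algebra of `K`, then `α^R` annihilates the fibres of the projection:
a curve in the fibre `K g`, translated by `g⁻¹`, is a curve in `K`. -/
theorem rightForm_eq_zero (hπ : IsSubmersion 𝓘(ℝ, E) 𝓘(ℝ, F) ∞ (proj K))
    {α : Module.Dual ℝ (GroupLieAlgebra 𝓘(ℝ, E) G)}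
    (hα : ∀ a ∈ subgroupLieAlgebra E K, α a = 0) (g : G) {v : E}
    (hv : tderiv E F (proj K) g v = 0) : rightForm α g v = 0 := by
  have := LieGroup.toContMDiffMul (I := 𝓘(ℝ, E)) (n := ∞) (G := G)
  have := this.toIsManifold
  obtain ⟨ε, c, hε, hc, hfib, hc0, hcv⟩ :=
    exists_curve_of_tderiv_eq_zero (hπ.isSubmersionAt g) hv
  refine hα _ ⟨ε, fun t => c t * g⁻¹, hε, ?_, ?_, by simp [hc0], ?_⟩
  · exact (contMDiff_mul_right (I := 𝓘(ℝ, E)) (n := ∞) (a := g⁻¹)).comp_contMDiffOn hc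
  · exact fun t ht => mul_inv_mem_of_proj_eq (hfib t ht)
  · have hcd : MDifferentiableAt 𝓘(ℝ, ℝ) 𝓘(ℝ, E) c 0 :=
      (hc.contMDiffAt (Ioo_mem_nhds (by linarith) hε)).mdifferentiableAt (by simp)
    have h1 := tderiv_comp (g := fun x : G => x * g⁻¹) (f := c) 0
      (mdifferentiableAt_mul_right g⁻¹ _) hcd
    have h2 := DFunLike.congr_fun h1 1
    rw [ContinuousLinearMap.comp_apply, hcv, hc0] at h2
    exact h2

end Annihilator

/-! ### The metric in a chart as the inverse of the contravariant tensor -/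

section Metric

variable {F : Type*} [NormedAddCommGroup F] [NormedSpace ℝ F] [FiniteDimensional ℝ F]
  {M : Type*} [TopologicalSpace M] [ChartedSpace F M]

/-- The contravariant metric `g^{ij}` at `p` in the preferred chart at `m`, as a map from covectors
to vectors. -/
def cometric (T : ∀ m : M, TangentSpace 𝓘(ℝ, F) m ⊗[ℝ] TangentSpace 𝓘(ℝ, F) m) (m p : M) :
    (F →L[ℝ] ℝ) →L[ℝ] F :=
  sharp (TensorProduct.map (tderiv F F (extChartAt 𝓘(ℝ, F) m) p : F →ₗ[ℝ] F)
    (tderiv F F (extChartAt 𝓘(ℝ, F) m) p : F →ₗ[ℝ] F) (show F ⊗[ℝ] F from T p))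

theorem cometric_apply (T : ∀ m : M, TangentSpace 𝓘(ℝ, F) m ⊗[ℝ] TangentSpace 𝓘(ℝ, F) m)
    (m p : M) (ξ : F →L[ℝ] ℝ) :
    cometric T m p ξ = tderiv F F (extChartAt 𝓘(ℝ, F) m) p
      (sharp (show F ⊗[ℝ] F from T p) (ξ.comp (tderiv F F (extChartAt 𝓘(ℝ, F) m) p))) :=
  sharp_map _ _ _

variable {T : ∀ m : M, TangentSpace 𝓘(ℝ, F) m ⊗[ℝ] TangentSpace 𝓘(ℝ, F) m}

theorem cometric_self [IsManifold 𝓘(ℝ, F) 1 M] (m : M) :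
    cometric T m m = sharp (show F ⊗[ℝ] F from T m) := by
  ext1 ξ
  rw [cometric_apply, tderiv_extChartAt_self, ContinuousLinearMap.comp_id,
    ContinuousLinearMap.id_apply]

theorem metricInChart_cometric [IsManifold 𝓘(ℝ, F) 1 M] {m : M} {y : F}
    (hy : y ∈ (extChartAt 𝓘(ℝ, F) m).target)
    (hT : Function.Bijective (cometric T m ((extChartAt 𝓘(ℝ, F) m).symm y)))
    (ξ : F →L[ℝ] ℝ) (v : F) :
    metricInChart T m y (cometric T m ((extChartAt 𝓘(ℝ, F) m).symm y) ξ) v = ξ v := by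
  set p := (extChartAt 𝓘(ℝ, F) m).symm y with hp
  set D := tderiv F F (extChartAt 𝓘(ℝ, F) m) p with hD
  set D' := tderiv F F (extChartAt 𝓘(ℝ, F) m).symm y with hD'
  have h1 : D.comp D' = ContinuousLinearMap.id ℝ F := tderiv_extChartAt_comp_symm m hy
  have h2 : D'.comp D = ContinuousLinearMap.id ℝ F := tderiv_extChartAt_symm_comp m hy
  have h1' (u : F) : D (D' u) = u := DFunLike.congr_fun h1 u
  have h2' (u : F) : D' (D u) = u := DFunLike.congr_fun h2 u
  have hnd : Nondegenerate (show F ⊗[ℝ] F from T p) := by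
    rw [nondegenerate_iff_bijective_sharp]
    constructor
    · intro ξ η h
      have h3 : cometric T m p (ξ.comp D') = cometric T m p (η.comp D') := by
        rw [cometric_apply, cometric_apply, ContinuousLinearMap.comp_assoc,
          ContinuousLinearMap.comp_assoc, h2, ContinuousLinearMap.comp_id,
          ContinuousLinearMap.comp_id, h]
      ext u
      simpa [h2'] using DFunLike.congr_fun (hT.1 h3) (D u)
    · intro u
      obtain ⟨ξ, hξ⟩ := hT.2 (D u)
      rw [cometric_apply] at hξ
      exact ⟨ξ.comp D, by rw [← h2' (sharp _ _), hξ, h2']⟩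
  have h3 : metricInChart T m y (cometric T m p ξ) v =
      covariantForm (show F ⊗[ℝ] F from T p) (D' (cometric T m p ξ)) (D' v) := rfl
  rw [h3, cometric_apply, h2', covariantForm_sharp hnd, ContinuousLinearMap.comp_apply, h1']

theorem metricInChart_symm [IsManifold 𝓘(ℝ, F) 1 M] {m : M} {y : F}
    (hy : y ∈ (extChartAt 𝓘(ℝ, F) m).target)
    (hT : Function.Bijective (cometric T m ((extChartAt 𝓘(ℝ, F) m).symm y)))
    (hsymm : ∀ ξ η : F →L[ℝ] ℝ, ξ (cometric T m ((extChartAt 𝓘(ℝ, F) m).symm y) η) =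
      η (cometric T m ((extChartAt 𝓘(ℝ, F) m).symm y) ξ)) (u v : F) :
    metricInChart T m y u v = metricInChart T m y v u := by
  obtain ⟨ξ, rfl⟩ := hT.2 u
  obtain ⟨η, rfl⟩ := hT.2 v
  rw [metricInChart_cometric hy hT, metricInChart_cometric hy hT, hsymm]

/-- Nondegeneracy is an open condition. -/
theorem eventually_bijective_cometric [IsManifold 𝓘(ℝ, F) 1 M] {m : M}
    (hT : m ∈ nondegenerateLocus T)
    (hc : ContinuousAt (fun y => cometric T m ((extChartAt 𝓘(ℝ, F) m).symm y))
      (extChartAt 𝓘(ℝ, F) m m)) :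
    ∀ᶠ y in 𝓝 (extChartAt 𝓘(ℝ, F) m m),
      Function.Bijective (cometric T m ((extChartAt 𝓘(ℝ, F) m).symm y)) := by
  have h0 : Function.Bijective (sharp (show F ⊗[ℝ] F from T m)) :=
    (nondegenerate_iff_bijective_sharp _).1 hT
  let e : (F →L[ℝ] ℝ) ≃L[ℝ] F := (LinearEquiv.ofBijective
    (sharp (show F ⊗[ℝ] F from T m)).toLinearMap h0).toContinuousLinearEquiv
  have he : (e : (F →L[ℝ] ℝ) →L[ℝ] F) =
      cometric T m ((extChartAt 𝓘(ℝ, F) m).symm (extChartAt 𝓘(ℝ, F) m m)) := by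
    rw [extChartAt_to_inv, cometric_self]
    rfl
  filter_upwards [hc.eventually_mem (he ▸ ContinuousLinearEquiv.nhds e)] with y hy
  obtain ⟨e', he'⟩ := hy
  rw [← he']
  exact e'.bijective

theorem contDiffAt_metricInChart [IsManifold 𝓘(ℝ, F) 1 M] {m : M}
    (hT : m ∈ nondegenerateLocus T) {n : WithTop ℕ∞}
    (hc : ContDiffAt ℝ n (fun y => cometric T m ((extChartAt 𝓘(ℝ, F) m).symm y))
      (extChartAt 𝓘(ℝ, F) m m)) :
    ContDiffAt ℝ n (metricInChart T m) (extChartAt 𝓘(ℝ, F) m m) := by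
  have h0 : Function.Bijective (sharp (show F ⊗[ℝ] F from T m)) :=
    (nondegenerate_iff_bijective_sharp _).1 hT
  let e : (F →L[ℝ] ℝ) ≃L[ℝ] F := (LinearEquiv.ofBijective
    (sharp (show F ⊗[ℝ] F from T m)).toLinearMap h0).toContinuousLinearEquiv
  have he : (e : (F →L[ℝ] ℝ) →L[ℝ] F) =
      cometric T m ((extChartAt 𝓘(ℝ, F) m).symm (extChartAt 𝓘(ℝ, F) m m)) := by
    rw [extChartAt_to_inv, cometric_self]
    rfl
  have h1 : ContDiffAt ℝ n ContinuousLinearMap.inverse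
      (cometric T m ((extChartAt 𝓘(ℝ, F) m).symm (extChartAt 𝓘(ℝ, F) m m))) :=
    he ▸ contDiffAt_map_inverse e
  refine (ContDiffAt.comp (f := fun y => cometric T m ((extChartAt 𝓘(ℝ, F) m).symm y)) _
    h1 hc).congr_of_eventuallyEq ?_
  filter_upwards [eventually_bijective_cometric hT hc.continuousAt,
    extChartAt_target_mem_nhds (I := 𝓘(ℝ, F)) m] with y hy hyt
  ext u v
  obtain ⟨ξ, rfl⟩ := hy.2 u
  let e' : (F →L[ℝ] ℝ) ≃L[ℝ] F := (LinearEquiv.ofBijective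
    (cometric T m ((extChartAt 𝓘(ℝ, F) m).symm y)).toLinearMap hy).toContinuousLinearEquiv
  have he' : cometric T m ((extChartAt 𝓘(ℝ, F) m).symm y) = e' := rfl
  rw [metricInChart_cometric hyt hy, Function.comp_apply, he', ContinuousLinearMap.inverse_equiv]
  simp

end Metric

/-! ### The Lie-algebraic metric -/

section Homogeneous

variable {E : Type*} [NormedAddCommGroup E] [NormedSpace ℝ E]
  {F : Type*} [NormedAddCommGroup F] [NormedSpace ℝ F]
  {G : Type*} [TopologicalSpace G] [ChartedSpace E G] [Group G]
  {K : Subgroup G} [ChartedSpace F (CosetSpace K)]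

variable (F) in
/-- The projection `x ↦ K x` in the preferred chart at `K g`. -/
def projInChart (K : Subgroup G) [ChartedSpace F (CosetSpace K)] (g x : G) : F :=
  extChartAt 𝓘(ℝ, F) (proj K g) (proj K x)

theorem eventually_proj_mem_source (hπ : IsSubmersion 𝓘(ℝ, E) 𝓘(ℝ, F) ∞ (proj K)) (g : G) :
    ∀ᶠ x in 𝓝 g, proj K x ∈ (extChartAt 𝓘(ℝ, F) (proj K g)).source :=
  (hπ.isSubmersionAt g).contMDiffAt.continuousAt.eventually_mem
    (extChartAt_source_mem_nhds (I := 𝓘(ℝ, F)) _)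

variable [IsManifold 𝓘(ℝ, F) ∞ (CosetSpace K)]

theorem contMDiffAt_projInChart (hπ : IsSubmersion 𝓘(ℝ, E) 𝓘(ℝ, F) ∞ (proj K)) {g x : G}
    (hx : proj K x ∈ (extChartAt 𝓘(ℝ, F) (proj K g)).source) :
    ContMDiffAt 𝓘(ℝ, E) 𝓘(ℝ, F) ∞ (projInChart F K g) x :=
  ContMDiffAt.comp (g := extChartAt 𝓘(ℝ, F) (proj K g)) x
    (contMDiffAt_extChartAt' (by rwa [← extChartAt_source 𝓘(ℝ, F)]))
    (hπ.isSubmersionAt x).contMDiffAt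

theorem tderiv_projInChart (hπ : IsSubmersion 𝓘(ℝ, E) 𝓘(ℝ, F) ∞ (proj K)) {g x : G}
    (hx : proj K x ∈ (extChartAt 𝓘(ℝ, F) (proj K g)).source) :
    tderiv E F (projInChart F K g) x =
      (tderiv F F (extChartAt 𝓘(ℝ, F) (proj K g)) (proj K x)).comp (tderiv E F (proj K) x) := by
  have := IsManifold.of_le (M := CosetSpace K) (I := 𝓘(ℝ, F)) (m := 1) (n := ∞) (by simp)
  exact tderiv_comp (g := extChartAt 𝓘(ℝ, F) (proj K g)) x
    (mdifferentiableAt_extChartAt (by rwa [← extChartAt_source 𝓘(ℝ, F)]))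
    ((hπ.isSubmersionAt x).contMDiffAt.mdifferentiableAt (by simp))

theorem surjective_tderiv_projInChart (hπ : IsSubmersion 𝓘(ℝ, E) 𝓘(ℝ, F) ∞ (proj K)) (g : G) :
    Function.Surjective (tderiv E F (projInChart F K g) g) := by
  obtain ⟨σ, hσ, hσ0, hσy⟩ := exists_section_of_isSubmersionAt (hπ.isSubmersionAt g)
  have h1 := tderiv_comp (g := projInChart F K g) (f := σ) _
    (by rw [hσ0]; exact (contMDiffAt_projInChart hπ (by simp)).mdifferentiableAt (by simp))
    (hσ.mdifferentiableAt (by simp))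
  have h2 : (fun y => projInChart F K g (σ y)) =ᶠ[𝓝 (extChartAt 𝓘(ℝ, F) (proj K g) (proj K g))]
      id := by
    filter_upwards [hσy, extChartAt_target_mem_nhds (I := 𝓘(ℝ, F)) (proj K g)] with y hy hyt
    rw [projInChart, hy, (extChartAt 𝓘(ℝ, F) (proj K g)).right_inv hyt, id]
  rw [tderiv_congr h2, hσ0, tderiv_eq_fderiv, fderiv_id] at h1
  exact fun v => ⟨_, (DFunLike.congr_fun h1 v).symm⟩

variable [FiniteDimensional ℝ E] [FiniteDimensional ℝ F] [LieGroup 𝓘(ℝ, E) ∞ G]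

/-- At the point `K x`, the metric tensor is the image of `C` under `leftDeriv` of the
projection. -/
theorem cometric_proj (hπ : IsSubmersion 𝓘(ℝ, E) 𝓘(ℝ, F) ∞ (proj K))
    (C : GroupLieAlgebra 𝓘(ℝ, E) G ⊗[ℝ] GroupLieAlgebra 𝓘(ℝ, E) G) {g x : G}
    (hx : proj K x ∈ (extChartAt 𝓘(ℝ, F) (proj K g)).source) (ξ : F →L[ℝ] ℝ) :
    cometric (metricTensor (F := F) K C) (proj K g) (proj K x) ξ =
      leftDeriv E (projInChart F K g) x (sharp (show E ⊗[ℝ] E from C)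
        (ξ.comp (leftDeriv E (projInChart F K g) x))) := by
  have hd : MDifferentiable 𝓘(ℝ, E) 𝓘(ℝ, F) (proj K) := fun x =>
    (hπ.isSubmersionAt x).contMDiffAt.mdifferentiableAt (by simp)
  rw [cometric_apply, metricTensor_proj K hd C x,
    leftDeriv_eq ((contMDiffAt_projInChart hπ hx).mdifferentiableAt (by simp)),
    tderiv_projInChart hπ hx]
  have h1 (ξ : F →L[ℝ] ℝ) : sharp (show F ⊗[ℝ] F from projTensor (F := F) K C x) ξ =
      tderiv E F (proj K) x (leftTrans E x (sharp (show E ⊗[ℝ] E from C)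
        ((ξ.comp (tderiv E F (proj K) x)).comp (leftTrans E x)))) :=
    (sharp_map (tderiv E F (proj K) x) (show E ⊗[ℝ] E from leftTensor C x) ξ).trans
      (congrArg _ (sharp_map (leftTrans E x) (show E ⊗[ℝ] E from C) _))
  rw [h1]
  rfl

set_option maxSynthPendingDepth 3 in
theorem contDiffAt_cometric (hπ : IsSubmersion 𝓘(ℝ, E) 𝓘(ℝ, F) ∞ (proj K))
    (C : GroupLieAlgebra 𝓘(ℝ, E) G ⊗[ℝ] GroupLieAlgebra 𝓘(ℝ, E) G) (g : G) :
    ContDiffAt ℝ ∞ (fun y => cometric (metricTensor (F := F) K C) (proj K g)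
      ((extChartAt 𝓘(ℝ, F) (proj K g)).symm y)) (extChartAt 𝓘(ℝ, F) (proj K g) (proj K g)) := by
  obtain ⟨σ, hσ, hσ0, hσy⟩ := exists_section_of_isSubmersionAt (hπ.isSubmersionAt g)
  have h1 := ContMDiffAt.comp (g := leftDeriv E (projInChart F K g)) _
    (contMDiffAt_leftDeriv (contMDiffAt_projInChart hπ (by rw [hσ0]; simp))) hσ
  rw [contMDiffAt_iff_contDiffAt] at h1
  set A : F → E →L[ℝ] F := leftDeriv E (projInChart F K g) ∘ σ
  have h2 : ContDiffAt ℝ ∞ (fun y => (A y).comp ((sharp (show E ⊗[ℝ] E from C)).comp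
      ((ContinuousLinearMap.compL ℝ E F ℝ).flip (A y))))
      (extChartAt 𝓘(ℝ, F) (proj K g) (proj K g)) :=
    h1.clm_comp (contDiffAt_const.clm_comp
      ((ContinuousLinearMap.compL ℝ E F ℝ).flip.contDiff.contDiffAt.comp _ h1))
  refine h2.congr_of_eventuallyEq ?_
  have h3 := eventually_proj_mem_source (F := F) hπ g
  rw [← hσ0] at h3
  filter_upwards [hσy, hσ.continuousAt.eventually h3] with y hy hys
  rw [hσ0] at hys
  ext1 ξ
  rw [← hy]
  exact cometric_proj hπ C hys ξ

end Homogeneous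

/-! ### Product rule and Lie bracket in terms of vector-valued functions -/

section Calculus

variable {E : Type*} [NormedAddCommGroup E] [NormedSpace ℝ E]
  {F : Type*} [NormedAddCommGroup F] [NormedSpace ℝ F]
  {H : Type*} [NormedAddCommGroup H] [NormedSpace ℝ H]
  {M : Type*} [TopologicalSpace M] [ChartedSpace E M]

theorem mdifferentiableAt_of_comp_extChartAt_symm {f : M → F} {x : M}
    (hf : DifferentiableAt ℝ (fun y => f ((extChartAt 𝓘(ℝ, E) x).symm y))
      (extChartAt 𝓘(ℝ, E) x x)) :
    MDifferentiableAt 𝓘(ℝ, E) 𝓘(ℝ, F) f x := by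
  have h := MDifferentiableAt.comp x hf.mdifferentiableAt
    ((contMDiffAt_extChartAt (I := 𝓘(ℝ, E)) (n := ∞) (x := x)).mdifferentiableAt (by simp))
  refine h.congr_of_eventuallyEq ?_
  filter_upwards [extChartAt_source_mem_nhds (I := 𝓘(ℝ, E)) x] with z hz
  simp only [Function.comp]
  rw [(extChartAt 𝓘(ℝ, E) x).left_inv hz]

variable [IsManifold 𝓘(ℝ, E) ∞ M]

theorem differentiableAt_comp_extChartAt_symm {f : M → F} {x : M}
    (hf : MDifferentiableAt 𝓘(ℝ, E) 𝓘(ℝ, F) f x) :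
    DifferentiableAt ℝ (fun y => f ((extChartAt 𝓘(ℝ, E) x).symm y)) (extChartAt 𝓘(ℝ, E) x x) := by
  rw [← mdifferentiableAt_iff_differentiableAt]
  refine MDifferentiableAt.comp (g := f) _ ?_
    ((contMDiffAt_extChartAt_symm_self x).mdifferentiableAt (by simp))
  rwa [extChartAt_to_inv]

theorem tderiv_clm_apply {A : M → F →L[ℝ] H} {u : M → F} {x : M}
    (hA : MDifferentiableAt 𝓘(ℝ, E) 𝓘(ℝ, F →L[ℝ] H) A x)
    (hu : MDifferentiableAt 𝓘(ℝ, E) 𝓘(ℝ, F) u x) (v : E) :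
    tderiv E H (fun y => A y (u y)) x v =
      tderiv E (F →L[ℝ] H) A x v (u x) + A x (tderiv E F u x v) := by
  have := IsManifold.of_le (M := M) (I := 𝓘(ℝ, E)) (m := 1) (n := ∞) (by simp)
  rw [tderiv_eq_fderiv_comp_symm (hA.clm_apply hu), tderiv_eq_fderiv_comp_symm hA,
    tderiv_eq_fderiv_comp_symm hu, fderiv_clm_apply (differentiableAt_comp_extChartAt_symm hA)
      (differentiableAt_comp_extChartAt_symm hu)]
  simp [add_comm]

/-- The Lie bracket of vector fields is the commutator of the derivations `f ↦ df(X)`. -/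
theorem tderiv_mlieBracket {f : M → F} {x : M} (hf : ContMDiffAt 𝓘(ℝ, E) 𝓘(ℝ, F) ∞ f x)
    {X Y : ∀ y : M, TangentSpace 𝓘(ℝ, E) y}
    (hX : MDifferentiableAt 𝓘(ℝ, E) 𝓘(ℝ, E)
      (fun y => tderiv E E (extChartAt 𝓘(ℝ, E) x) y (X y)) x)
    (hY : MDifferentiableAt 𝓘(ℝ, E) 𝓘(ℝ, E)
      (fun y => tderiv E E (extChartAt 𝓘(ℝ, E) x) y (Y y)) x) :
    tderiv E F f x (VectorField.mlieBracket 𝓘(ℝ, E) X Y x) =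
      tderiv E F (fun y => tderiv E F f y (Y y)) x (X x) -
        tderiv E F (fun y => tderiv E F f y (X y)) x (Y x) := by
  have := IsManifold.of_le (M := M) (I := 𝓘(ℝ, E)) (m := 1) (n := ∞) (by simp)
  set Φ := (extChartAt 𝓘(ℝ, E) x).symm
  set e := extChartAt 𝓘(ℝ, E) x x
  set Xc : E → E := fun y => tderiv E E (extChartAt 𝓘(ℝ, E) x) (Φ y) (X (Φ y))
  set Yc : E → E := fun y => tderiv E E (extChartAt 𝓘(ℝ, E) x) (Φ y) (Y (Φ y))
  set fc : E → F := fun y => f (Φ y)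
  have hΦe : Φ e = x := extChartAt_to_inv x
  have htarget := extChartAt_target_mem_nhds (I := 𝓘(ℝ, E)) x
  have hfc : ContDiffAt ℝ ∞ fc e := contMDiffAt_comp_extChartAt_symm le_rfl hf
  have hval (Z : ∀ y : M, TangentSpace 𝓘(ℝ, E) y) :
      tderiv E E (extChartAt 𝓘(ℝ, E) x) (Φ e) (Z (Φ e)) = Z x := by
    rw [hΦe, tderiv_extChartAt_self]
    rfl
  -- the coordinate expression of a vector field and of the derivative along it
  have hpull (Z : ∀ y : M, TangentSpace 𝓘(ℝ, E) y) :
      VectorField.mpullbackWithin 𝓘(ℝ, E) 𝓘(ℝ, E) Φ Z univ =ᶠ[𝓝 e]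
        fun y => tderiv E E (extChartAt 𝓘(ℝ, E) x) (Φ y) (Z (Φ y)) := by
    filter_upwards [htarget] with y hy
    rw [VectorField.mpullbackWithin_apply, mfderivWithin_univ]
    have h := ContinuousLinearMap.inverse_eq (tderiv_extChartAt_symm_comp x hy)
      (tderiv_extChartAt_comp_symm x hy)
    exact DFunLike.congr_fun h (Z (Φ y))
  have hf1 : ∀ᶠ y in 𝓝 e, MDifferentiableAt 𝓘(ℝ, E) 𝓘(ℝ, F) f (Φ y) := by
    have h1 := (contMDiffAt_iff_contMDiffAt_nhds (by simp)).1
      (hf.of_le (show (1 : WithTop ℕ∞) ≤ ∞ by simp))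
    have h2 := (contMDiffAt_extChartAt_symm_self (E := E) x).continuousAt
    rw [ContinuousAt, extChartAt_to_inv] at h2
    filter_upwards [h2.eventually h1] with y hy using hy.mdifferentiableAt (by simp)
  have hder (Z : ∀ y : M, TangentSpace 𝓘(ℝ, E) y) :
      (fun y => tderiv E F f (Φ y) (Z (Φ y))) =ᶠ[𝓝 e] fun y => fderiv ℝ fc y
        (tderiv E E (extChartAt 𝓘(ℝ, E) x) (Φ y) (Z (Φ y))) := by
    filter_upwards [htarget, hf1] with y hy hfy
    have h1 := tderiv_comp (g := f) (f := Φ) y hfy (mdifferentiableAt_extChartAt_symm x hy)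
    have h2 := DFunLike.congr_fun (tderiv_extChartAt_symm_comp x hy) (Z (Φ y))
    rw [tderiv_eq_fderiv] at h1
    rw [h1, ContinuousLinearMap.comp_apply]
    exact congrArg (tderiv E F f (Φ y)) h2.symm
  have hsnd (Z : ∀ y : M, TangentSpace 𝓘(ℝ, E) y)
      (hZ : MDifferentiableAt 𝓘(ℝ, E) 𝓘(ℝ, E)
        (fun y => tderiv E E (extChartAt 𝓘(ℝ, E) x) y (Z y)) x) (v : E) :
      tderiv E F (fun y => tderiv E F f y (Z y)) x v =
        fderiv ℝ (fderiv ℝ fc) e v (Z x) + fderiv ℝ fc e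
          (fderiv ℝ (fun y => tderiv E E (extChartAt 𝓘(ℝ, E) x) (Φ y) (Z (Φ y))) e v) := by
    have h1 := ((hfc.fderiv_right (m := ∞) (by simp)).differentiableAt (by simp)).clm_apply
      (differentiableAt_comp_extChartAt_symm hZ)
    have h2 : MDifferentiableAt 𝓘(ℝ, E) 𝓘(ℝ, F) (fun y => tderiv E F f y (Z y)) x :=
      mdifferentiableAt_of_comp_extChartAt_symm (h1.congr_of_eventuallyEq (hder Z))
    rw [tderiv_eq_fderiv_comp_symm h2, (hder Z).fderiv_eq, fderiv_clm_apply
      ((hfc.fderiv_right (m := ∞) (by simp)).differentiableAt (by simp))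
      (differentiableAt_comp_extChartAt_symm hZ), add_apply, add_comm]
    simp only [ContinuousLinearMap.flip_apply, ContinuousLinearMap.comp_apply]
    rw [hval Z]
  have hbr : (show E from VectorField.mlieBracket 𝓘(ℝ, E) X Y x) =
      fderiv ℝ Yc e (X x) - fderiv ℝ Xc e (Y x) := by
    let Xp : E → E := VectorField.mpullbackWithin 𝓘(ℝ, E) 𝓘(ℝ, E) Φ X univ
    let Yp : E → E := VectorField.mpullbackWithin 𝓘(ℝ, E) 𝓘(ℝ, E) Φ Y univ
    have h1 : (show E from VectorField.mlieBracket 𝓘(ℝ, E) X Y x) =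
        (tderiv E E (extChartAt 𝓘(ℝ, E) x) x).inverse
          (VectorField.lieBracketWithin ℝ Xp Yp univ e) := by
      have h2 := VectorField.mlieBracketWithin_apply (I := 𝓘(ℝ, E)) (V := X) (W := Y)
        (s := univ) (x₀ := x)
      rw [modelWithCornersSelf_coe, range_id, preimage_univ, univ_inter,
        VectorField.mlieBracketWithin_univ] at h2
      exact h2
    have hXp : Xp =ᶠ[𝓝 e] Xc := hpull X
    have hYp : Yp =ᶠ[𝓝 e] Yc := hpull Y
    have hXe : Xc e = X x := hval X
    have hYe : Yc e = Y x := hval Y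
    refine h1.trans ?_
    rw [tderiv_extChartAt_self, ContinuousLinearMap.inverse_id,
      VectorField.lieBracketWithin_univ, hXp.lieBracket_vectorField_eq hYp, ← hXe, ← hYe]
    rfl
  have hsymm := hfc.isSymmSndFDerivAt
    (by rw [minSmoothness_of_isRCLikeNormedField]; exact WithTop.coe_le_coe.2 le_top) (X x) (Y x)
  refine (congrArg (tderiv E F f x) hbr).trans
    (Eq.trans ?_ (congrArg₂ (· - ·) (hsnd Y hY (X x)) (hsnd X hX (Y x))).symm)
  rw [tderiv_eq_fderiv_comp_symm (hf.mdifferentiableAt (by simp)), hsymm,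
    add_sub_add_left_eq_sub, ← map_sub]

end Calculus

/-! ### The Koszul formula for projected horizontal fields -/

section Core

variable {E : Type*} [NormedAddCommGroup E] [NormedSpace ℝ E] [FiniteDimensional ℝ E]
  {F : Type*} [NormedAddCommGroup F] [NormedSpace ℝ F] [FiniteDimensional ℝ F]
  {G : Type*} [TopologicalSpace G] [ChartedSpace E G] [Group G] [LieGroup 𝓘(ℝ, E) ∞ G]
  {K : Subgroup G} [ChartedSpace F (CosetSpace K)] [IsManifold 𝓘(ℝ, F) ∞ (CosetSpace K)]

/-- The derivative of `f` along the horizontal field of `α`, in terms of derivatives along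
left-invariant fields. Applied to `projInChart F K g`, it is the section `π_* H^α` in the preferred
chart at `K g`. -/
def horizontalDeriv {H : Type*} [NormedAddCommGroup H] [NormedSpace ℝ H]
    (C : GroupLieAlgebra 𝓘(ℝ, E) G ⊗[ℝ] GroupLieAlgebra 𝓘(ℝ, E) G)
    (α : Module.Dual ℝ (GroupLieAlgebra 𝓘(ℝ, E) G)) (f : G → H) (x : G) : H :=
  leftDeriv E f x (sharp (show E ⊗[ℝ] E from C)
    (rightFormLeft (LinearMap.toContinuousLinearMap (show E →ₗ[ℝ] ℝ from α)) x))

variable (C : GroupLieAlgebra 𝓘(ℝ, E) G ⊗[ℝ] GroupLieAlgebra 𝓘(ℝ, E) G)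
    {α β : Module.Dual ℝ (GroupLieAlgebra 𝓘(ℝ, E) G)}

theorem horizontalDeriv_eq {H : Type*} [NormedAddCommGroup H] [NormedSpace ℝ H]
    {f : G → H} {x : G} (hf : MDifferentiableAt 𝓘(ℝ, E) 𝓘(ℝ, H) f x) :
    horizontalDeriv C α f x = tderiv E H f x (horizontalField C α x) := by
  rw [horizontalDeriv, leftDeriv_eq hf]
  exact congrArg _ (horizontalField_eq C α x).symm

theorem contMDiffAt_horizontalDeriv {H : Type*} [NormedAddCommGroup H] [NormedSpace ℝ H]
    {f : G → H} {x : G} (hf : ContMDiffAt 𝓘(ℝ, E) 𝓘(ℝ, H) ∞ f x) :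
    ContMDiffAt 𝓘(ℝ, E) 𝓘(ℝ, H) ∞ (horizontalDeriv C α f) x :=
  (contMDiffAt_leftDeriv hf).clm_apply
    (contMDiffAt_const.clm_apply (contMDiffAt_rightFormLeft _ x))

variable {C}

/-- The `C^π`-dual of `π_* H^β` is the covector on the base whose pullback is `β^R`. -/
theorem metricInChart_horizontalDeriv
    (hπ : IsSubmersion 𝓘(ℝ, E) 𝓘(ℝ, F) ∞ (proj K))
    (hβ : ∀ a ∈ subgroupLieAlgebra E K, β a = 0) {g x : G}
    (hx : proj K x ∈ (extChartAt 𝓘(ℝ, F) (proj K g)).source)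
    (hbij : Function.Bijective (cometric (metricTensor (F := F) K C) (proj K g) (proj K x)))
    (v : E) :
    metricInChart (metricTensor (F := F) K C) (proj K g) (projInChart F K g x)
      (horizontalDeriv C β (projInChart F K g) x) (tderiv E F (projInChart F K g) x v) =
        rightForm β x v := by
  have := IsManifold.of_le (M := CosetSpace K) (I := 𝓘(ℝ, F)) (m := 1) (n := ∞) (by simp)
  set P := projInChart F K g with hP
  have hPx : MDifferentiableAt 𝓘(ℝ, E) 𝓘(ℝ, F) P x :=
    (contMDiffAt_projInChart hπ hx).mdifferentiableAt (by simp)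
  have hinv : (extChartAt 𝓘(ℝ, F) (proj K g)).symm (P x) = proj K x :=
    (extChartAt 𝓘(ℝ, F) (proj K g)).left_inv hx
  -- `β^R` vanishes on the kernel of `dP`, hence factors through `dP`
  have hker : ∀ v : E, tderiv E F P x v = 0 → rightForm β x v = 0 := by
    intro v hv
    refine rightForm_eq_zero (F := F) hπ hβ x ?_
    rw [hP, tderiv_projInChart hπ hx] at hv
    exact (isInvertible_mfderiv_extChartAt hx).injective (hv.trans (map_zero _).symm)
  obtain ⟨θ, hθ⟩ : ∃ θ : F →L[ℝ] ℝ, ∀ v : E, rightForm β x v = θ (tderiv E F P x v) := by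
    have h1 : (show E →ₗ[ℝ] ℝ from rightForm β x) ∈
        LinearMap.range (tderiv E F P x : E →ₗ[ℝ] F).dualMap := by
      rw [LinearMap.range_dualMap_eq_dualAnnihilator_ker, Submodule.mem_dualAnnihilator]
      exact fun w hw => hker w hw
    obtain ⟨θ, hθ⟩ := h1
    exact ⟨LinearMap.toContinuousLinearMap θ, fun v => (DFunLike.congr_fun hθ v).symm⟩
  have hform : rightFormLeft (LinearMap.toContinuousLinearMap (show E →ₗ[ℝ] ℝ from β)) x =
      θ.comp (leftDeriv E P x) := by
    ext v
    rw [← rightForm_leftTrans, hθ, leftDeriv_eq hPx]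
    rfl
  have hU : horizontalDeriv C β P x =
      cometric (metricTensor (F := F) K C) (proj K g) (proj K x) θ := by
    rw [horizontalDeriv, hform, cometric_proj hπ C hx]
  have h2 := metricInChart_cometric (T := metricTensor (F := F) K C) (m := proj K g)
    (y := P x) ((extChartAt 𝓘(ℝ, F) (proj K g)).map_source hx) (by rwa [hinv]) θ
    (tderiv E F P x v)
  rw [hinv] at h2
  rw [hU, h2, hθ]

theorem cometric_symm (hπ : IsSubmersion 𝓘(ℝ, E) 𝓘(ℝ, F) ∞ (proj K))
    (hC : TensorProduct.comm ℝ _ _ C = C) {g x : G}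
    (hx : proj K x ∈ (extChartAt 𝓘(ℝ, F) (proj K g)).source) (ξ η : F →L[ℝ] ℝ) :
    ξ (cometric (metricTensor (F := F) K C) (proj K g) (proj K x) η) =
      η (cometric (metricTensor (F := F) K C) (proj K g) (proj K x) ξ) := by
  rw [cometric_proj hπ C hx, cometric_proj hπ C hx]
  exact sharp_symm (T := show E ⊗[ℝ] E from C) hC (ξ.comp _) (η.comp _)

/-- In a neighbourhood of `g` the preferred chart at `K g` is defined and the metric is
nondegenerate. -/
theorem eventually_source_and_bijective (hπ : IsSubmersion 𝓘(ℝ, E) 𝓘(ℝ, F) ∞ (proj K)) {g : G}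
    (hg : proj K g ∈ nondegenerateLocus (metricTensor (F := F) K C)) :
    ∀ᶠ x in 𝓝 g, proj K x ∈ (extChartAt 𝓘(ℝ, F) (proj K g)).source ∧
      Function.Bijective (cometric (metricTensor (F := F) K C) (proj K g) (proj K x)) := by
  have := IsManifold.of_le (M := CosetSpace K) (I := 𝓘(ℝ, F)) (m := 1) (n := ∞) (by simp)
  have hP : ContinuousAt (projInChart F K g) g :=
    (contMDiffAt_projInChart hπ (by simp)).continuousAt
  filter_upwards [eventually_proj_mem_source (F := F) hπ g, hP.eventually
    (eventually_bijective_cometric hg (contDiffAt_cometric hπ C g).continuousAt)] with x hx hb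
  refine ⟨hx, ?_⟩
  rwa [projInChart, (extChartAt 𝓘(ℝ, F) (proj K g)).left_inv hx] at hb

theorem mdifferentiableAt_metricInChart_projInChart
    (hπ : IsSubmersion 𝓘(ℝ, E) 𝓘(ℝ, F) ∞ (proj K)) {g : G}
    (hg : proj K g ∈ nondegenerateLocus (metricTensor (F := F) K C)) :
    MDifferentiableAt 𝓘(ℝ, E) 𝓘(ℝ, F →L[ℝ] F →L[ℝ] ℝ) (fun x => metricInChart
      (metricTensor (F := F) K C) (proj K g) (projInChart F K g x)) g ∧
    ∀ v : E, tderiv E (F →L[ℝ] F →L[ℝ] ℝ) (fun x => metricInChart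
      (metricTensor (F := F) K C) (proj K g) (projInChart F K g x)) g v =
      fderiv ℝ (metricInChart (metricTensor (F := F) K C) (proj K g))
        (extChartAt 𝓘(ℝ, F) (proj K g) (proj K g)) (tderiv E F (projInChart F K g) g v) := by
  have := IsManifold.of_le (M := CosetSpace K) (I := 𝓘(ℝ, F)) (m := 1) (n := ∞) (by simp)
  have h1 := ((contDiffAt_metricInChart hg (contDiffAt_cometric hπ C g)).differentiableAt
    (by simp)).mdifferentiableAt
  have h2 : MDifferentiableAt 𝓘(ℝ, E) 𝓘(ℝ, F) (projInChart F K g) g :=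
    (contMDiffAt_projInChart hπ (by simp)).mdifferentiableAt (by simp)
  refine ⟨h1.comp g h2, fun v => ?_⟩
  rw [tderiv_comp g h1 h2, tderiv_eq_fderiv]
  rfl

/-- The derivative along `H^α` of the constant pairing of `π_* H^β` with the projection of a
right-invariant field. -/
theorem fderiv_metricInChart_horizontalDeriv (hπ : IsSubmersion 𝓘(ℝ, E) 𝓘(ℝ, F) ∞ (proj K))
    (hβ : ∀ a ∈ subgroupLieAlgebra E K, β a = 0) {g : G}
    (hg : proj K g ∈ nondegenerateLocus (metricTensor (F := F) K C)) (b : E) :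
    fderiv ℝ (metricInChart (metricTensor (F := F) K C) (proj K g))
        (extChartAt 𝓘(ℝ, F) (proj K g) (proj K g)) (horizontalDeriv C α (projInChart F K g) g)
        (horizontalDeriv C β (projInChart F K g) g) (rightDeriv E (projInChart F K g) g b) +
      metricInChart (metricTensor (F := F) K C) (proj K g) (projInChart F K g g)
        (horizontalDeriv C α (horizontalDeriv C β (projInChart F K g)) g)
        (rightDeriv E (projInChart F K g) g b) +
      metricInChart (metricTensor (F := F) K C) (proj K g) (projInChart F K g g)
        (horizontalDeriv C β (projInChart F K g) g)
        (horizontalDeriv C α (rightDeriv E (projInChart F K g)) g b) = 0 := by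
  set P := projInChart F K g
  have hP : ContMDiffAt 𝓘(ℝ, E) 𝓘(ℝ, F) ∞ P g := contMDiffAt_projInChart hπ (by simp)
  have hV := (contMDiffAt_horizontalDeriv (C := C) (α := β) hP).mdifferentiableAt (by simp)
  have hR := (contMDiffAt_rightDeriv hP).mdifferentiableAt (by simp)
  have hRb := hR.clm_apply (mdifferentiableAt_const (c := b))
  obtain ⟨hm, hm'⟩ := mdifferentiableAt_metricInChart_projInChart (C := C) hπ hg
  have hconst : (fun x => metricInChart (metricTensor (F := F) K C) (proj K g) (P x)
      (horizontalDeriv C β P x) (rightDeriv E P x b)) =ᶠ[𝓝 g] fun _ => β b := by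
    filter_upwards [eventually_source_and_bijective hπ hg] with x hx
    have h1 : rightDeriv E P x b = tderiv E F P x (rightTrans E x b) := by
      rw [rightDeriv_eq ((contMDiffAt_projInChart hπ hx.1).mdifferentiableAt (by simp))]
      rfl
    rw [h1, metricInChart_horizontalDeriv hπ hβ hx.1 hx.2, rightForm_rightTrans]
  have h0 : tderiv E ℝ (fun _ : G => β b) g = 0 := mfderiv_const (I := 𝓘(ℝ, E))
  obtain ⟨X, hX⟩ : ∃ X : E, X = horizontalField C α g := ⟨_, rfl⟩
  have hconst' := DFunLike.congr_fun ((tderiv_congr hconst).trans h0) X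
  rw [tderiv_clm_apply (hm.clm_apply hV) hRb, tderiv_clm_apply hm hV, hm',
    tderiv_clm_apply hR mdifferentiableAt_const] at hconst'
  have h2 : tderiv E E (fun _ : G => b) g = 0 := mfderiv_const (I := 𝓘(ℝ, E))
  simp only [h2, add_apply, zero_apply, map_zero, add_zero] at hconst'
  rwa [hX, ← horizontalDeriv_eq C (hP.mdifferentiableAt (by simp)), ← horizontalDeriv_eq C hV,
    ← horizontalDeriv_eq C hR] at hconst'

/-- The derivative of `π_* H^α` along a right-invariant field, paired with `π_* H^β`; right- and
left-invariant fields commute. -/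
theorem metricInChart_tderiv_horizontalDeriv (hπ : IsSubmersion 𝓘(ℝ, E) 𝓘(ℝ, F) ∞ (proj K))
    (hβ : ∀ a ∈ subgroupLieAlgebra E K, β a = 0) {g : G}
    (hg : proj K g ∈ nondegenerateLocus (metricTensor (F := F) K C)) (b : E) :
    metricInChart (metricTensor (F := F) K C) (proj K g) (projInChart F K g g)
        (horizontalDeriv C β (projInChart F K g) g)
        (tderiv E F (horizontalDeriv C α (projInChart F K g)) g (rightTrans E g b)) =
      metricInChart (metricTensor (F := F) K C) (proj K g) (projInChart F K g g)
        (horizontalDeriv C β (projInChart F K g) g)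
        (horizontalDeriv C α (rightDeriv E (projInChart F K g)) g b) +
      rightFormLeft (LinearMap.toContinuousLinearMap (show E →ₗ[ℝ] ℝ from β)) g
        (sharp (show E ⊗[ℝ] E from C) (tderiv E (E →L[ℝ] ℝ)
          (rightFormLeft (LinearMap.toContinuousLinearMap (show E →ₗ[ℝ] ℝ from α))) g
          (rightTrans E g b))) := by
  set P := projInChart F K g
  have hP : ContMDiffAt 𝓘(ℝ, E) 𝓘(ℝ, F) ∞ P g := contMDiffAt_projInChart hπ (by simp)
  have hP' := hP.mdifferentiableAt (by simp)
  have hA := (contMDiffAt_leftDeriv hP).mdifferentiableAt (by simp)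
  have hR := (contMDiffAt_rightDeriv hP).mdifferentiableAt (by simp)
  set α' := LinearMap.toContinuousLinearMap (show E →ₗ[ℝ] ℝ from α)
  set S := sharp (show E ⊗[ℝ] E from C)
  have hα := (contMDiffAt_rightFormLeft α' g).mdifferentiableAt (by simp)
  have hS : MDifferentiableAt 𝓘(ℝ, E) 𝓘(ℝ, (E →L[ℝ] ℝ) →L[ℝ] E) (fun _ : G => S) g :=
    mdifferentiableAt_const
  have h0 : tderiv E ((E →L[ℝ] ℝ) →L[ℝ] E) (fun _ : G => S) g = 0 :=
    mfderiv_const (I := 𝓘(ℝ, E))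
  have h1 : tderiv E F (horizontalDeriv C α P) g (rightTrans E g b) =
      horizontalDeriv C α (rightDeriv E P) g b + leftDeriv E P g (S
        (tderiv E (E →L[ℝ] ℝ) (rightFormLeft α') g (rightTrans E g b))) := by
    refine (tderiv_clm_apply hA (hS.clm_apply hα) _).trans ?_
    rw [tderiv_leftDeriv_rightTrans hP, tderiv_clm_apply hS hα, h0, horizontalDeriv,
      leftDeriv_eq hR]
    simp [S, α']
  have hx := (eventually_source_and_bijective hπ hg).self_of_nhds
  have h2 (z : E) := metricInChart_horizontalDeriv hπ hβ hx.1 hx.2 (leftTrans E g z)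
  rw [h1, map_add]
  congr 1
  rw [leftDeriv_eq hP', ContinuousLinearMap.comp_apply, h2, rightForm_leftTrans]

/-- The Koszul formula for `π_* H^α` and `π_* H^β`, tested on projections of right-invariant
fields. -/
theorem koszul_horizontalDeriv (hπ : IsSubmersion 𝓘(ℝ, E) 𝓘(ℝ, F) ∞ (proj K))
    (hC : TensorProduct.comm ℝ _ _ C = C)
    (hα : ∀ a ∈ subgroupLieAlgebra E K, α a = 0)
    (hβ : ∀ a ∈ subgroupLieAlgebra E K, β a = 0) {g : G}
    (hg : proj K g ∈ nondegenerateLocus (metricTensor (F := F) K C)) (w : F) :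
    fderiv ℝ (metricInChart (metricTensor (F := F) K C) (proj K g))
        (extChartAt 𝓘(ℝ, F) (proj K g) (proj K g)) (horizontalDeriv C α (projInChart F K g) g)
        (horizontalDeriv C β (projInChart F K g) g) w +
      fderiv ℝ (metricInChart (metricTensor (F := F) K C) (proj K g))
        (extChartAt 𝓘(ℝ, F) (proj K g) (proj K g)) (horizontalDeriv C β (projInChart F K g) g)
        (horizontalDeriv C α (projInChart F K g) g) w -
      fderiv ℝ (metricInChart (metricTensor (F := F) K C) (proj K g))
        (extChartAt 𝓘(ℝ, F) (proj K g) (proj K g)) w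
        (horizontalDeriv C α (projInChart F K g) g) (horizontalDeriv C β (projInChart F K g) g) =
    - metricInChart (metricTensor (F := F) K C) (proj K g) (projInChart F K g g)
        (horizontalDeriv C α (horizontalDeriv C β (projInChart F K g)) g +
          horizontalDeriv C β (horizontalDeriv C α (projInChart F K g)) g) w := by
  have := IsManifold.of_le (M := CosetSpace K) (I := 𝓘(ℝ, F)) (m := 1) (n := ∞) (by simp)
  obtain ⟨v, rfl⟩ := surjective_tderiv_projInChart (F := F) hπ g w
  obtain ⟨b, rfl⟩ := rightTrans_surjective g v
  have e1 := fderiv_metricInChart_horizontalDeriv (α := α) hπ hβ hg b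
  have e2 := fderiv_metricInChart_horizontalDeriv (α := β) hπ hα hg b
  have e3 := metricInChart_tderiv_horizontalDeriv (α := α) hπ hβ hg b
  have e4 := metricInChart_tderiv_horizontalDeriv (α := β) hπ hα hg b
  have hP : ContMDiffAt 𝓘(ℝ, E) 𝓘(ℝ, F) ∞ (projInChart F K g) g :=
    contMDiffAt_projInChart hπ (by simp)
  have hx := (eventually_source_and_bijective hπ hg).self_of_nhds
  have hsymm (u v : F) := metricInChart_symm (T := metricTensor (F := F) K C) (m := proj K g)
    (y := projInChart F K g g) ((extChartAt 𝓘(ℝ, F) (proj K g)).map_source hx.1)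
    (by rw [projInChart, extChartAt_to_inv]; exact hx.2)
    (by rw [projInChart, extChartAt_to_inv]; exact cometric_symm hπ hC hx.1) u v
  rw [rightDeriv_eq (hP.mdifferentiableAt (by simp)), ContinuousLinearMap.comp_apply] at e1 e2
  set P := projInChart F K g
  set α' := LinearMap.toContinuousLinearMap (show E →ₗ[ℝ] ℝ from α)
  set β' := LinearMap.toContinuousLinearMap (show E →ₗ[ℝ] ℝ from β)
  set S := sharp (show E ⊗[ℝ] E from C)
  have hU := (contMDiffAt_horizontalDeriv (C := C) (α := α) hP).mdifferentiableAt (by simp)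
  have hV := (contMDiffAt_horizontalDeriv (C := C) (α := β) hP).mdifferentiableAt (by simp)
  obtain ⟨hm, hm'⟩ := mdifferentiableAt_metricInChart_projInChart (C := C) hπ hg
  have hα' := (contMDiffAt_rightFormLeft α' g).mdifferentiableAt (by simp)
  have hβ' := (contMDiffAt_rightFormLeft β' g).mdifferentiableAt (by simp)
  have hS : MDifferentiableAt 𝓘(ℝ, E) 𝓘(ℝ, (E →L[ℝ] ℝ) →L[ℝ] E) (fun _ : G => S) g :=
    mdifferentiableAt_const
  have h0 : tderiv E ((E →L[ℝ] ℝ) →L[ℝ] E) (fun _ : G => S) g = 0 :=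
    mfderiv_const (I := 𝓘(ℝ, E))
  -- the derivative of the function `C(α^R, β^R)` along a right-invariant field
  have hpair : (fun x => metricInChart (metricTensor (F := F) K C) (proj K g) (P x)
      (horizontalDeriv C α P x) (horizontalDeriv C β P x)) =ᶠ[𝓝 g]
        fun x => rightFormLeft α' x (S (rightFormLeft β' x)) := by
    filter_upwards [eventually_source_and_bijective hπ hg] with x hx
    have h1 : horizontalDeriv C β P x =
        tderiv E F P x (leftTrans E x (S (rightFormLeft β' x))) := by
      rw [horizontalDeriv,
        leftDeriv_eq ((contMDiffAt_projInChart hπ hx.1).mdifferentiableAt (by simp))]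
      rfl
    rw [h1, metricInChart_horizontalDeriv hπ hα hx.1 hx.2, rightForm_leftTrans]
  have e5 := DFunLike.congr_fun (tderiv_congr (E := E) (E' := ℝ) hpair) (rightTrans E g b)
  rw [tderiv_clm_apply (hm.clm_apply hU) hV, tderiv_clm_apply hm hU, hm',
    tderiv_clm_apply hα' (hS.clm_apply hβ'), tderiv_clm_apply hS hβ', h0] at e5
  have e6 := sharp_symm (T := show E ⊗[ℝ] E from C) hC
    (tderiv E (E →L[ℝ] ℝ) (rightFormLeft α') g (rightTrans E g b)) (rightFormLeft β' g)
  simp only [add_apply, zero_apply, zero_add, map_add]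
    at e5 ⊢
  have e7 := hsymm (tderiv E F (horizontalDeriv C α P) g (rightTrans E g b))
    (horizontalDeriv C β P g)
  linarith

/-- The covariant derivative along `H^α` of `π_* H^β`, in coordinates. -/
theorem horizontalDeriv_add_christoffel (hπ : IsSubmersion 𝓘(ℝ, E) 𝓘(ℝ, F) ∞ (proj K))
    (hC : TensorProduct.comm ℝ _ _ C = C)
    (hα : ∀ a ∈ subgroupLieAlgebra E K, α a = 0)
    (hβ : ∀ a ∈ subgroupLieAlgebra E K, β a = 0) {g : G}
    (hg : proj K g ∈ nondegenerateLocus (metricTensor (F := F) K C)) :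
    horizontalDeriv C α (horizontalDeriv C β (projInChart F K g)) g +
      (show F from christoffel (metricTensor (F := F) K C) (proj K g)
        (show F from horizontalDeriv C α (projInChart F K g) g)
        (show F from horizontalDeriv C β (projInChart F K g) g)) =
    (1 / 2 : ℝ) • (horizontalDeriv C α (horizontalDeriv C β (projInChart F K g)) g -
      horizontalDeriv C β (horizontalDeriv C α (projInChart F K g)) g) := by
  have := IsManifold.of_le (M := CosetSpace K) (I := 𝓘(ℝ, F)) (m := 1) (n := ∞) (by simp)
  set P := projInChart F K g
  set U := horizontalDeriv C α P g
  set V := horizontalDeriv C β P g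
  set XV := horizontalDeriv C α (horizontalDeriv C β P) g
  set YU := horizontalDeriv C β (horizontalDeriv C α P) g
  set dg := fderiv ℝ (metricInChart (metricTensor (F := F) K C) (proj K g))
    (extChartAt 𝓘(ℝ, F) (proj K g) (proj K g))
  set ξ : F →L[ℝ] ℝ := (1 / 2 : ℝ) • (dg U V + dg V U - (dg.flip U).flip V)
  have hx := (eventually_source_and_bijective hπ hg).self_of_nhds
  set c := cometric (metricTensor (F := F) K C) (proj K g) (proj K g) with hc
  have hΓ : (show F from christoffel (metricTensor (F := F) K C) (proj K g)
      (show F from U) (show F from V)) = c ξ := by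
    rw [hc, cometric_self]
    rfl
  have hinv : (extChartAt 𝓘(ℝ, F) (proj K g)).symm (P g) = proj K g := extChartAt_to_inv _
  have hmc (ξ : F →L[ℝ] ℝ) (w : F) := metricInChart_cometric (T := metricTensor (F := F) K C)
    (m := proj K g) (y := P g) ((extChartAt 𝓘(ℝ, F) (proj K g)).map_source hx.1)
    (by rw [hinv]; exact hx.2) ξ w
  rw [hinv, ← hc] at hmc
  obtain ⟨η, hη⟩ := hx.2.2 (XV + YU)
  have hξ : ξ = (-(1 / 2) : ℝ) • η := by
    ext w
    have h1 := koszul_horizontalDeriv hπ hC hα hβ hg w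
    have h2 := hmc η w
    rw [hc, hη] at h2
    rw [h2] at h1
    have h3 : ξ w = (1 / 2 : ℝ) * (dg U V w + dg V U w - dg w U V) := rfl
    rw [h3, h1, smul_apply, smul_eq_mul]
    ring
  rw [hΓ, hξ, map_smul, hc, hη]
  module

end Core

/-! ### Smoothness of integral curves -/

section IntegralCurve

variable {E : Type*} [NormedAddCommGroup E] [NormedSpace ℝ E]
  {M : Type*} [TopologicalSpace M] [ChartedSpace E M] [IsManifold 𝓘(ℝ, E) ∞ M]

/-- An integral curve of a smooth vector field is smooth: its velocity is as regular as the curve,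
so the regularity improves by one degree at a time. -/
theorem contMDiffAt_of_isMIntegralCurveOn {X : ∀ y : M, TangentSpace 𝓘(ℝ, E) y}
    (hX : ∀ x, ContMDiffAt 𝓘(ℝ, E) 𝓘(ℝ, E) ∞
      (fun y => tderiv E E (extChartAt 𝓘(ℝ, E) x) y (X y)) x)
    {γ : ℝ → M} {J : Set ℝ} (hJ : IsOpen J) (hγ : IsMIntegralCurveOn (I := 𝓘(ℝ, E)) γ X J)
    {t : ℝ} (ht : t ∈ J) : ContMDiffAt 𝓘(ℝ, ℝ) 𝓘(ℝ, E) ∞ γ t := by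
  have := IsManifold.of_le (M := M) (I := 𝓘(ℝ, E)) (m := 1) (n := ∞) (by simp)
  have hd : ∀ t ∈ J, HasMFDerivAt 𝓘(ℝ, ℝ) 𝓘(ℝ, E) γ t
      ((1 : ℝ →L[ℝ] ℝ).smulRight (X (γ t))) := fun t ht =>
    (hγ t ht).hasMFDerivAt (hJ.mem_nhds ht)
  have hnear : ∀ t ∈ J, ∀ᶠ t' in 𝓝 t, t' ∈ J ∧ γ t' ∈ (extChartAt 𝓘(ℝ, E) (γ t)).source :=
    fun t ht => (hJ.eventually_mem ht).and ((hd t ht).continuousAt.eventually_mem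
      (extChartAt_source_mem_nhds (I := 𝓘(ℝ, E)) _))
  have key : ∀ n : ℕ, ∀ t ∈ J, ContDiffAt ℝ n (fun t' => extChartAt 𝓘(ℝ, E) (γ t) (γ t')) t := by
    intro n
    induction n with
    | zero =>
      intro t ht
      refine contDiffAt_zero.2 ⟨_, hnear t ht, fun t' ht' => ?_⟩
      exact (ContinuousAt.comp (g := extChartAt 𝓘(ℝ, E) (γ t))
        (continuousAt_extChartAt' ht'.2) (hd t' ht'.1).continuousAt).continuousWithinAt
    | succ n ih =>
      intro t ht
      have hγn : ContMDiffAt 𝓘(ℝ, ℝ) 𝓘(ℝ, E) n γ t :=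
        contMDiffAt_iff_target.2 ⟨(hd t ht).continuousAt, (ih t ht).contMDiffAt⟩
      have h1 := ((hX (γ t)).of_le (by exact_mod_cast le_top)).comp t hγn
      rw [contMDiffAt_iff_contDiffAt] at h1
      refine contDiffAt_succ_iff_hasFDerivAt.2 ⟨fun t' => (1 : ℝ →L[ℝ] ℝ).smulRight
        (tderiv E E (extChartAt 𝓘(ℝ, E) (γ t)) (γ t') (X (γ t'))), ⟨_, hnear t ht, ?_⟩,
        contDiffAt_const.smulRight h1⟩
      intro t' ht'
      have h2 : MDifferentiableAt 𝓘(ℝ, E) 𝓘(ℝ, E) (extChartAt 𝓘(ℝ, E) (γ t)) (γ t') :=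
        mdifferentiableAt_extChartAt (by rw [← extChartAt_source 𝓘(ℝ, E)]; exact ht'.2)
      have h3 := (h2.hasMFDerivAt.comp t' (hd t' ht'.1)).hasFDerivAt
      refine h3.congr_fderiv ?_
      ext
      exact (congrArg (tderiv E E (extChartAt 𝓘(ℝ, E) (γ t)) (γ t'))
        (one_smul ℝ (show E from X (γ t')))).trans (one_smul ℝ _).symm
  refine contMDiffAt_infty.2 fun n => contMDiffAt_iff_target.2
    ⟨(hd t ht).continuousAt, (key n t ht).contMDiffAt⟩

end IntegralCurve

/-! ### Covariant derivatives of projected horizontal fields -/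

section Horizontal

variable {E : Type*} [NormedAddCommGroup E] [NormedSpace ℝ E] [FiniteDimensional ℝ E]
  {F : Type*} [NormedAddCommGroup F] [NormedSpace ℝ F]
  {G : Type*} [TopologicalSpace G] [ChartedSpace E G] [Group G] [LieGroup 𝓘(ℝ, E) ∞ G]
  {K : Subgroup G} [ChartedSpace F (CosetSpace K)] [IsManifold 𝓘(ℝ, F) ∞ (CosetSpace K)]
  {C : GroupLieAlgebra 𝓘(ℝ, E) G ⊗[ℝ] GroupLieAlgebra 𝓘(ℝ, E) G}
  {α β : Module.Dual ℝ (GroupLieAlgebra 𝓘(ℝ, E) G)}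

theorem tderiv_extChartAt_projVector (hπ : IsSubmersion 𝓘(ℝ, E) 𝓘(ℝ, F) ∞ (proj K)) {g x : G}
    (hx : proj K x ∈ (extChartAt 𝓘(ℝ, F) (proj K g)).source) :
    tderiv F F (extChartAt 𝓘(ℝ, F) (proj K g)) (proj K x)
      (projVector (F := F) K x (horizontalField C α x)) =
        horizontalDeriv C α (projInChart F K g) x := by
  rw [horizontalDeriv_eq C ((contMDiffAt_projInChart hπ hx).mdifferentiableAt (by simp)),
    tderiv_projInChart hπ hx]
  rfl

theorem projVector_horizontalField (hπ : IsSubmersion 𝓘(ℝ, E) 𝓘(ℝ, F) ∞ (proj K)) (g : G) :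
    (show F from projVector (F := F) K g (horizontalField C α g)) =
      horizontalDeriv C α (projInChart F K g) g := by
  have := IsManifold.of_le (M := CosetSpace K) (I := 𝓘(ℝ, F)) (m := 1) (n := ∞) (by simp)
  rw [← tderiv_extChartAt_projVector hπ (by simp), tderiv_extChartAt_self]
  rfl

theorem contMDiffAt_horizontalField (g : G) :
    ContMDiffAt 𝓘(ℝ, E) 𝓘(ℝ, E) ∞
      (fun y => tderiv E E (extChartAt 𝓘(ℝ, E) g) y (horizontalField C α y)) g := by
  have := LieGroup.toContMDiffMul (I := 𝓘(ℝ, E)) (n := ∞) (G := G)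
  have := this.toIsManifold
  have := IsManifold.of_le (M := G) (I := 𝓘(ℝ, E)) (m := 1) (n := ∞) (by simp)
  refine (contMDiffAt_horizontalDeriv (C := C) (α := α)
    (contMDiffAt_extChartAt (I := 𝓘(ℝ, E)) (n := ∞) (x := g))).congr_of_eventuallyEq ?_
  filter_upwards [extChartAt_source_mem_nhds (I := 𝓘(ℝ, E)) g] with x hx
  exact (horizontalDeriv_eq C
    (mdifferentiableAt_extChartAt (by rwa [← extChartAt_source 𝓘(ℝ, E)]))).symm

theorem projVector_mlieBracket (hπ : IsSubmersion 𝓘(ℝ, E) 𝓘(ℝ, F) ∞ (proj K)) (g : G) :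
    (show F from projVector (F := F) K g
      (VectorField.mlieBracket 𝓘(ℝ, E) (horizontalField C α) (horizontalField C β) g)) =
    horizontalDeriv C α (horizontalDeriv C β (projInChart F K g)) g -
      horizontalDeriv C β (horizontalDeriv C α (projInChart F K g)) g := by
  have := LieGroup.toContMDiffMul (I := 𝓘(ℝ, E)) (n := ∞) (G := G)
  have := this.toIsManifold
  have := IsManifold.of_le (M := CosetSpace K) (I := 𝓘(ℝ, F)) (m := 1) (n := ∞) (by simp)
  have hP : ContMDiffAt 𝓘(ℝ, E) 𝓘(ℝ, F) ∞ (projInChart F K g) g :=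
    contMDiffAt_projInChart hπ (by simp)
  have h1 := tderiv_mlieBracket hP
    ((contMDiffAt_horizontalField (C := C) (α := α) g).mdifferentiableAt (by simp))
    ((contMDiffAt_horizontalField (C := C) (α := β) g).mdifferentiableAt (by simp))
  have h2 (α : Module.Dual ℝ (GroupLieAlgebra 𝓘(ℝ, E) G)) :
      (fun y => tderiv E F (projInChart F K g) y (horizontalField C α y)) =ᶠ[𝓝 g]
        horizontalDeriv C α (projInChart F K g) := by
    filter_upwards [eventually_proj_mem_source (F := F) hπ g] with x hx
    exact (horizontalDeriv_eq C
      ((contMDiffAt_projInChart hπ hx).mdifferentiableAt (by simp))).symm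
  rw [tderiv_congr (h2 α), tderiv_congr (h2 β),
    ← horizontalDeriv_eq C ((contMDiffAt_horizontalDeriv C hP).mdifferentiableAt (by simp)),
    ← horizontalDeriv_eq C ((contMDiffAt_horizontalDeriv C hP).mdifferentiableAt (by simp)),
    tderiv_projInChart hπ (by simp), tderiv_extChartAt_self] at h1
  exact h1

variable [FiniteDimensional ℝ F]

theorem pullbackCovDeriv_horizontalField (hπ : IsSubmersion 𝓘(ℝ, E) 𝓘(ℝ, F) ∞ (proj K))
    (hC : TensorProduct.comm ℝ _ _ C = C)
    (hα : ∀ a ∈ subgroupLieAlgebra E K, α a = 0)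
    (hβ : ∀ a ∈ subgroupLieAlgebra E K, β a = 0) {g : G}
    (hg : proj K g ∈ nondegenerateLocus (metricTensor (F := F) K C)) :
    pullbackCovDeriv (metricTensor (F := F) K C) (proj K)
        (fun x => projVector (F := F) K x (horizontalField C β x)) g (horizontalField C α g) =
      (1 / 2 : ℝ) • projVector (F := F) K g
        (VectorField.mlieBracket 𝓘(ℝ, E) (horizontalField C α) (horizontalField C β) g) := by
  have h1 : (fun x => tderiv F F (extChartAt 𝓘(ℝ, F) (proj K g)) (proj K x)
      (projVector (F := F) K x (horizontalField C β x))) =ᶠ[𝓝 g]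
        horizontalDeriv C β (projInChart F K g) := by
    filter_upwards [eventually_proj_mem_source (F := F) hπ g] with x hx
    exact tderiv_extChartAt_projVector hπ hx
  have hP : ContMDiffAt 𝓘(ℝ, E) 𝓘(ℝ, F) ∞ (projInChart F K g) g :=
    contMDiffAt_projInChart hπ (by simp)
  have h2 := DFunLike.congr_fun (tderiv_congr (E := E) (E' := F) h1) (horizontalField C α g)
  have h3 := horizontalDeriv_eq (C := C) (α := α)
    ((contMDiffAt_horizontalDeriv (C := C) (α := β) hP).mdifferentiableAt (by simp))
  have h4 := horizontalDeriv_add_christoffel hπ hC hα hβ hg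
  rw [← projVector_mlieBracket hπ, ← projVector_horizontalField hπ,
    ← projVector_horizontalField hπ] at h4
  exact (congrArg (· + (show F from christoffel (metricTensor (F := F) K C) (proj K g)
    (projVector (F := F) K g (horizontalField C α g))
    (projVector (F := F) K g (horizontalField C β g)))) (h2.trans h3.symm)).trans h4

theorem isGeodesicOn_proj (hπ : IsSubmersion 𝓘(ℝ, E) 𝓘(ℝ, F) ∞ (proj K))
    (hC : TensorProduct.comm ℝ _ _ C = C)
    (hα : ∀ a ∈ subgroupLieAlgebra E K, α a = 0) {J : Set ℝ} {γ : ℝ → G} (hJ : IsOpen J)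
    (hγ : IsMIntegralCurveOn (I := 𝓘(ℝ, E)) γ (horizontalField C α) J) :
    IsGeodesicOn (metricTensor (F := F) K C) (fun t => proj K (γ t))
      {t ∈ J | proj K (γ t) ∈ nondegenerateLocus (metricTensor (F := F) K C)} := by
  have := LieGroup.toContMDiffMul (I := 𝓘(ℝ, E)) (n := ∞) (G := G)
  have := this.toIsManifold
  rintro t ⟨ht, hg⟩
  have hγs := contMDiffAt_of_isMIntegralCurveOn contMDiffAt_horizontalField hJ hγ ht
  refine ⟨hg, (hπ.isSubmersionAt (γ t)).contMDiffAt.comp t hγs, ?_⟩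
  have hd : ∀ t ∈ J, HasMFDerivAt 𝓘(ℝ, ℝ) 𝓘(ℝ, E) γ t
      ((1 : ℝ →L[ℝ] ℝ).smulRight (horizontalField C α (γ t))) := fun t ht =>
    (hγ t ht).hasMFDerivAt (hJ.mem_nhds ht)
  have hdγ : ∀ t ∈ J, tderiv ℝ E γ t 1 = horizontalField C α (γ t) := fun t ht => by
    have h := DFunLike.congr_fun (hd t ht).mfderiv (1 : ℝ)
    refine h.trans ?_
    exact one_smul ℝ (show E from horizontalField C α (γ t))
  have hvel : ∀ t ∈ J, (show F from velocity (F := F) (fun t => proj K (γ t)) t) =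
      projVector (F := F) K (γ t) (horizontalField C α (γ t)) := fun t ht => by
    have h := tderiv_comp (E := ℝ) (g := proj K) (f := γ) t
      ((hπ.isSubmersionAt (γ t)).contMDiffAt.mdifferentiableAt (by simp))
      (hd t ht).mdifferentiableAt
    refine (DFunLike.congr_fun h (1 : ℝ)).trans ?_
    exact congrArg (tderiv E F (proj K) (γ t)) (hdγ t ht)
  set g := γ t with hgt
  have h1 : (fun t' => tderiv F F (extChartAt 𝓘(ℝ, F) (proj K g)) (proj K (γ t'))
      (show F from velocity (F := F) (fun t => proj K (γ t)) t')) =ᶠ[𝓝 t]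
        fun t' => horizontalDeriv C α (projInChart F K g) (γ t') := by
    filter_upwards [hJ.mem_nhds ht, hγs.continuousAt.eventually
      (eventually_proj_mem_source (F := F) hπ g)] with t' ht' hx
    exact (congrArg _ (hvel t' ht')).trans (tderiv_extChartAt_projVector hπ hx)
  have hP : ContMDiffAt 𝓘(ℝ, E) 𝓘(ℝ, F) ∞ (projInChart F K g) g :=
    contMDiffAt_projInChart hπ (by simp)
  have hU := (contMDiffAt_horizontalDeriv (C := C) (α := α) hP).mdifferentiableAt
    (show (∞ : WithTop ℕ∞) ≠ 0 by simp)
  have h2 := tderiv_comp (E := ℝ) (g := horizontalDeriv C α (projInChart F K g)) (f := γ) t hU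
    (hd t ht).mdifferentiableAt
  have h3 : tderiv ℝ F (fun t' => tderiv F F (extChartAt 𝓘(ℝ, F) (proj K g)) (proj K (γ t'))
      (show F from velocity (F := F) (fun t => proj K (γ t)) t')) t 1 =
        horizontalDeriv C α (horizontalDeriv C α (projInChart F K g)) g := by
    refine (DFunLike.congr_fun ((tderiv_congr h1).trans h2) 1).trans ?_
    rw [ContinuousLinearMap.comp_apply, horizontalDeriv_eq C hU]
    exact congrArg _ (hdγ t ht)
  have h4 := horizontalDeriv_add_christoffel hπ hC hα hα hg
  rw [sub_self, smul_zero, ← projVector_horizontalField hπ, ← hvel t ht] at h4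
  exact (congrArg (· + (show F from christoffel (metricTensor (F := F) K C) (proj K g)
    (velocity (F := F) (fun t => proj K (γ t)) t)
    (velocity (F := F) (fun t => proj K (γ t)) t))) h3).trans h4

end Horizontal

end LieAlgebraicMetric

end

open LieAlgebraicMetric in
theorem mainTheorem4
    {E : Type*} [NormedAddCommGroup E] [NormedSpace ℝ E] [FiniteDimensional ℝ E]
    {F : Type*} [NormedAddCommGroup F] [NormedSpace ℝ F] [FiniteDimensional ℝ F]
    {G : Type*} [TopologicalSpace G] [ChartedSpace E G] [Group G] [LieGroup 𝓘(ℝ, E) ∞ G]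
    (K : Subgroup G) (hK : IsClosed (K : Set G))
    [ChartedSpace F (CosetSpace K)] [IsManifold 𝓘(ℝ, F) ∞ (CosetSpace K)]
    (hπ : IsSubmersion 𝓘(ℝ, E) 𝓘(ℝ, F) ∞ (proj K))
    (C : GroupLieAlgebra 𝓘(ℝ, E) G ⊗[ℝ] GroupLieAlgebra 𝓘(ℝ, E) G)
    (hC : TensorProduct.comm ℝ _ _ C = C) :
    (∀ α : Module.Dual ℝ (GroupLieAlgebra 𝓘(ℝ, E) G),
      (∀ a ∈ subgroupLieAlgebra E K, α a = 0) →
      ∀ (J : Set ℝ) (γ : ℝ → G), IsOpen J →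
        IsMIntegralCurveOn (I := 𝓘(ℝ, E)) γ (horizontalField C α) J →
        IsGeodesicOn (metricTensor (F := F) K C) (fun t => proj K (γ t))
          {t ∈ J | proj K (γ t) ∈ nondegenerateLocus (metricTensor (F := F) K C)}) ∧
    (∀ α β : Module.Dual ℝ (GroupLieAlgebra 𝓘(ℝ, E) G),
      (∀ a ∈ subgroupLieAlgebra E K, α a = 0) →
      (∀ a ∈ subgroupLieAlgebra E K, β a = 0) →
      ∀ g : G, proj K g ∈ nondegenerateLocus (metricTensor (F := F) K C) →
        pullbackCovDeriv (metricTensor (F := F) K C) (proj K)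
            (fun x => projVector (F := F) K x (horizontalField C β x)) g
            (horizontalField C α g) =
          (1 / 2 : ℝ) • projVector (F := F) K g
            (VectorField.mlieBracket 𝓘(ℝ, E) (horizontalField C α) (horizontalField C β) g)) := by
  exact ⟨fun _ hα _ _ hJ hγ => isGeodesicOn_proj hπ hC hα hJ hγ,
    fun _ _ hα hβ _ hg => pullbackCovDeriv_horizontalField hπ hC hα hβ hg⟩
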